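/- **Setting.** Let $X$ be a finite-dimensional quantum system with canonical basis $\{|j\rangle\}$ and Hermitian Hamiltonian $H_X$, let $\beta>0$ and $n\in\mathbb N$. Write $H_{X^n}=\sum_{i=1}^n H_{X_i}$. For any finite-dimensional system $Y$ let $\Pi^\lambda_{Y^n}$ be the projector onto the Schur–Weyl block of $Y^{\otimes n}$ labelled by the Young diagram $\lambda$ with $n$ boxes, and let $S(\lambda/n)=-\sum_i\frac{\lambda_i}{n}\log\frac{\lambda_i}{n}$. Let $S^{E}_{X^n}$ be the projector onto the eigenspace of $H_{X^n}$ with eigenvalue $E$. A quantum channel is a completely positive, trace-preserving linear map. A channel $\mathcal E_{X\to X}$ is time-covariant if $\mathcal E(e^{-iH_Xt}\rho\, e^{iH_Xt})=e^{-iH_Xt}\mathcal E(\rho)e^{iH_Xt}$ for all $t\in\mathbb R$ and all $\rho$. **Work-cost-dephased map.** Let $R\simeq X$, $|\Phi\rangle_{X^n:R^n}=\sum_j|j\rangle_{X^n}\otimes|j\rangle_{R^n}$, $\Phi=|\Phi\rangle\langle\Phi|$, and for $w\in\mathbb R$ let $$\hat P^{(w)}_{X^nR^n}=\sum_{E-\beta^{-1}S(\mu/n)-E'+\beta^{-1}S(\lambda/n)=w}\bigl(S^{E}_{X^n}\Pi^\mu_{X^n}\bigr)\otimes\bigl(S^{E'}_{X^n}\Pi^\lambda_{X^n}\bigr)^{t}_{R^n},$$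 where $E,E'$ range over the distinct eigenvalues of $H_{X^n}$ and $\lambda,\mu$ over the Young diagrams with $n$ boxes. The work-cost-dephased map $\widetilde{\mathcal F}$ of a linear map $\mathcal F$ on the operators of $X^n$ is the linear map whose Choi matrix is $$\widetilde{\mathcal F}(\Phi_{X^n:R^n})=\sum_w\hat P^{(w)}_{X^nR^n}\,\mathcal F(\Phi_{X^n:R^n})\,\hat P^{(w)}_{X^nR^n},$$ the sum being over the finitely many values $w$ that occur. For a channel $\mathcal E_{X\to X}$, write $\widetilde{\mathcal E}_{X^n}$ for the work-cost-dephased map of $\mathcal E^{\otimes n}$. **Dephasing on $E^nX^n$.** Let $E$ be a finite-dimensional system with Hermitian Hamiltonian $H_E$. Let $R^{E_k}_{E^nX^n}$ be the projector onto the eigenspace with eigenvalue $E_k$ of $H_{E^nX^n}=\sum_{i=1}^n(H_{E_i}+H_{X_i})$. Set $$P^{(w)}_{E^nX^n}=\sum_{E_k-\beta^{-1}S(\lambda/n)-E_\ell+\beta^{-1}S(\mu/n)=w}S^{E_\ell}_{X^n}\Pi^\mu_{X^n}\Pi^\lambda_{(EX)^n}R^{E_k}_{E^nX^n},\qquad \mathcal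 D^{\mathrm W}_{E^nX^n}(\cdot)=\sum_wP^{(w)}_{E^nX^n}(\cdot)P^{(w)}_{E^nX^n},$$ where the first sum runs over the eigenvalues $E_k$ of $H_{E^nX^n}$, the eigenvalues $E_\ell$ of $H_{X^n}$ and the Young diagrams $\lambda,\mu$ with $n$ boxes, and the second over the finitely many values $w$ that occur. **Lemma.** Let $\mathcal E_{X\to X}$ be a time-covariant quantum channel with an energy-conserving Stinespring dilation, that is: a finite-dimensional system $E$ with Hermitian Hamiltonian $H_E$, a unit vector $|0\rangle_E$ with $\langle0|H_E|0\rangle=0$, and a unitary $V_{XE}$ commuting with $H_X+H_E$, such that $\mathcal E(\cdot)=\operatorname{tr}_E[V(|0\rangle\langle0|_E\otimes(\cdot))V^\dagger]$. Then $$\widetilde{\mathcal E}_{X^n}(\cdot)=\operatorname{tr}_{E^n}\Bigl\{\mathcal D^{\mathrm W}_{E^nX^n}\Bigl(V_{XE}^{\otimes n}\bigl[|0\rangle\langle0|_E^{\otimes n}\otimes(\cdot)\bigr](V_{XE}^{\otimes n})^\dagger\Bigr)\Bigr\}.$$ **Corollary.** For every quantum channel $\mathcal E_{X\to X}$ the map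 $\widetilde{\mathcal E}_{X^n}$ is completely positive and trace-preserving. More generally, for every quantum channel $\mathcal F$ on $X^n$ the work-cost-dephased map $\widetilde{\mathcal F}$ is completely positive and trace-preserving. -/

import Mathlib

open scoped Matrix Kronecker ComplexOrder

noncomputable section

namespace WorkCost

/-! A finite-dimensional system with canonical basis indexed by `x` has operators
`Matrix x x ℂ`; its `n`-fold copy has canonical basis indexed by `Fin n → x`. -/

section Systems

variable {x e : Type*} [Fintype x] [DecidableEq x] [Fintype e] [DecidableEq e]

/-- The operator `A 0 ⊗ ⋯ ⊗ A (n-1)` on `n` copies of a system. -/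
def tensorFamily {n : ℕ} (A : Fin n → Matrix x x ℂ) : Matrix (Fin n → x) (Fin n → x) ℂ :=
  Matrix.of fun a b => ∏ k, A k (a k) (b k)

/-- The tensor power `A^{⊗ n}` of an operator. -/
def tensorPow (n : ℕ) (A : Matrix x x ℂ) : Matrix (Fin n → x) (Fin n → x) ℂ :=
  tensorFamily fun _ => A

/-- The operator acting as `A` on the `i`-th copy and trivially on the others. -/
def siteOp (n : ℕ) (i : Fin n) (A : Matrix x x ℂ) : Matrix (Fin n → x) (Fin n → x) ℂ :=
  tensorFamily (Function.update (fun _ => (1 : Matrix x x ℂ)) i A)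

/-- The total Hamiltonian `∑ i, H_i` of `n` copies of a system with Hamiltonian `H`. -/
def totalHam (n : ℕ) (H : Matrix x x ℂ) : Matrix (Fin n → x) (Fin n → x) ℂ :=
  ∑ i, siteOp n i H

/-- The Hamiltonian `H_E ⊗ 1 + 1 ⊗ H_X` of the noninteracting joint system `EX`. -/
def jointHam (HE : Matrix e e ℂ) (HX : Matrix x x ℂ) : Matrix (e × x) (e × x) ℂ :=
  HE ⊗ₖ (1 : Matrix x x ℂ) + (1 : Matrix e e ℂ) ⊗ₖ HX

/-- The partial trace over the first tensor factor. -/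
def traceFst {a b : Type*} [Fintype a] (M : Matrix (a × b) (a × b) ℂ) : Matrix b b ℂ :=
  Matrix.of fun i j => ∑ c, M (c, i) (c, j)

/-- The identification of `Eⁿ Xⁿ` with `(EX)ⁿ` on canonical basis labels. -/
def zipEquiv (n : ℕ) (e x : Type*) : (Fin n → e) × (Fin n → x) ≃ (Fin n → e × x) :=
  (Equiv.arrowProdEquivProdArrow (Fin n) (fun _ => e) (fun _ => x)).symm

/-- The operator `A ⊗ B` with `A` acting on `Eⁿ` and `B` on `Xⁿ`, as an operator on `(EX)ⁿ`. -/
def tensorEnv {n : ℕ} (A : Matrix (Fin n → e) (Fin n → e) ℂ)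
    (B : Matrix (Fin n → x) (Fin n → x) ℂ) : Matrix (Fin n → e × x) (Fin n → e × x) ℂ :=
  Matrix.reindex (zipEquiv n e x) (zipEquiv n e x) (A ⊗ₖ B)

/-- The partial trace over `Eⁿ` of an operator on `(EX)ⁿ`. -/
def traceEnv {n : ℕ} (M : Matrix (Fin n → e × x) (Fin n → e × x) ℂ) :
    Matrix (Fin n → x) (Fin n → x) ℂ :=
  traceFst (Matrix.reindex (zipEquiv n e x).symm (zipEquiv n e x).symm M)

/-- The rank-one operator `|v⟩⟨v|`. -/
def ketBra (v : e → ℂ) : Matrix e e ℂ := Matrix.vecMulVec v (star v)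

end Systems

section Projectors

variable {ι : Type*} [Fintype ι] [DecidableEq ι]

/-- The matrix of the orthogonal projection onto a subspace of `ℂ^ι`. -/
def projMatrix (K : Submodule ℂ (EuclideanSpace ℂ ι)) : Matrix ι ι ℂ :=
  (Matrix.toEuclideanLin (𝕜 := ℂ)).symm (K.starProjection : _ →ₗ[ℂ] _)

/-- The finite set of (distinct) real eigenvalues of a matrix. -/
def energies (H : Matrix ι ι ℂ) : Finset ℝ :=
  (Matrix.finite_real_spectrum (A := H)).toFinset

/-- The projector onto the eigenspace of `H` with eigenvalue `E`. -/
def energyProj (H : Matrix ι ι ℂ) (E : ℝ) : Matrix ι ι ℂ :=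
  projMatrix (Module.End.eigenspace (Matrix.toEuclideanLin H) (E : ℂ))

end Projectors

section SchurWeyl

/-- The Young diagram whose row lengths are the parts of the partition `p`. -/
def diagram {n : ℕ} (p : Nat.Partition n) : YoungDiagram :=
  YoungDiagram.ofRowLens (p.parts.sort (· ≥ ·)) (p.parts.pairwise_sort (· ≥ ·)).sortedGE

/-- A tableau of shape `p`: a bijective placement of `0, …, n-1` in the cells of the diagram. -/
abbrev Tableau {n : ℕ} (p : Nat.Partition n) : Type := Fin n ≃ (diagram p).cells

open Classical in
/-- The Young symmetrizer of a tableau: the sum over the permutations `σ` preserving every row,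
times the signed sum over the permutations `τ` preserving every column. -/
def youngSymmetrizer {n : ℕ} {p : Nat.Partition n} (T : Tableau p) :
    MonoidAlgebra ℂ (Equiv.Perm (Fin n)) :=
  (∑ σ : Equiv.Perm (Fin n) with ∀ i, (T (σ i)).1.1 = (T i).1.1,
      MonoidAlgebra.of ℂ (Equiv.Perm (Fin n)) σ) *
  (∑ τ : Equiv.Perm (Fin n) with ∀ i, (T (τ i)).1.2 = (T i).1.2,
      ((Equiv.Perm.sign τ : ℤ) : ℂ) • MonoidAlgebra.of ℂ (Equiv.Perm (Fin n)) τ)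

variable {d : Type*} [Fintype d] [DecidableEq d]

/-- The unitary representation of permutations on `n` copies of a system, which permutes the
tensor factors: the basis vector `|b⟩` is sent to `|b ∘ σ⁻¹⟩`. -/
def permRep (n : ℕ) (d : Type*) [Fintype d] [DecidableEq d] :
    Equiv.Perm (Fin n) →* Matrix (Fin n → d) (Fin n → d) ℂ where
  toFun σ := Matrix.of fun a b => if a = b ∘ ⇑σ⁻¹ then 1 else 0
  map_one' := by
    ext a b
    simp [Matrix.one_apply]
  map_mul' σ τ := by
    ext a b
    simp only [Matrix.mul_apply, Matrix.of_apply, mul_ite, mul_one, mul_zero,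
      Finset.sum_ite_eq', Finset.mem_univ, if_true, mul_inv_rev, Equiv.Perm.coe_mul]
    rfl

/-- The action of the group algebra of the symmetric group on `n` copies of a system. -/
def permAlgRep (n : ℕ) (d : Type*) [Fintype d] [DecidableEq d] :
    MonoidAlgebra ℂ (Equiv.Perm (Fin n)) →ₐ[ℂ] Matrix (Fin n → d) (Fin n → d) ℂ :=
  MonoidAlgebra.lift ℂ _ _ (permRep n d)

/-- The Schur–Weyl block with Young diagram `p` in `n` copies of a system, that is, the isotypic
component of the corresponding irreducible representation of the symmetric group: the span of the
images of the Young symmetrizers of all tableaux of shape `p`. -/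
def schurWeylBlock {n : ℕ} (d : Type*) [Fintype d] [DecidableEq d] (p : Nat.Partition n) :
    Submodule ℂ (EuclideanSpace ℂ (Fin n → d)) :=
  ⨆ T : Tableau p, LinearMap.range
    (Matrix.toEuclideanLin (permAlgRep n d (youngSymmetrizer T)))

/-- The projector onto the Schur–Weyl block with Young diagram `p`. -/
def schurWeylProj {n : ℕ} (d : Type*) [Fintype d] [DecidableEq d] (p : Nat.Partition n) :
    Matrix (Fin n → d) (Fin n → d) ℂ :=
  projMatrix (schurWeylBlock d p)

/-- The Shannon entropy (in nats) of the probability distribution `p / n`. -/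
def shapeEntropy {n : ℕ} (p : Nat.Partition n) : ℝ :=
  (p.parts.map fun i => Real.negMulLog ((i : ℝ) / n)).sum

end SchurWeyl

section Channels

variable {x e : Type*} [Fintype x] [DecidableEq x] [Fintype e] [DecidableEq e]

/-- The Choi matrix `(F ⊗ id)(|Φ⟩⟨Φ|)`, `|Φ⟩ = ∑ j, |j⟩ ⊗ |j⟩`, of a linear map. -/
def choi (F : Matrix x x ℂ →ₗ[ℂ] Matrix x x ℂ) : Matrix (x × x) (x × x) ℂ :=
  Matrix.of fun p q => F (Matrix.single p.2 q.2 1) p.1 q.1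

/-- The linear map with a given Choi matrix. -/
def ofChoi (C : Matrix (x × x) (x × x) ℂ) : Matrix x x ℂ →ₗ[ℂ] Matrix x x ℂ where
  toFun ρ := Matrix.of fun i j => ∑ a, ∑ b, ρ a b * C (i, a) (j, b)
  map_add' ρ σ := by
    ext i j
    simp [add_mul, Finset.sum_add_distrib]
  map_smul' c ρ := by
    ext i j
    simp [Finset.mul_sum, mul_assoc]

theorem choi_ofChoi (C : Matrix (x × x) (x × x) ℂ) : choi (ofChoi C) = C := by
  ext ⟨i, a⟩ ⟨j, b⟩
  simp [choi, ofChoi, Matrix.single_apply, ite_and]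

theorem ofChoi_choi (F : Matrix x x ℂ →ₗ[ℂ] Matrix x x ℂ) : ofChoi (choi F) = F := by
  ext M i j
  have h : F M = ∑ a, ∑ b, M a b • F (Matrix.single a b 1) := by
    conv_lhs => rw [Matrix.matrix_eq_sum_single M]
    simp only [map_sum, ← map_smul, Matrix.smul_single, smul_eq_mul, mul_one]
  simp [h, choi, ofChoi, Matrix.sum_apply]

/-- `F ⊗ id` on the system together with a `k`-dimensional reference. -/
def ampliation (F : Matrix x x ℂ →ₗ[ℂ] Matrix x x ℂ) (k : ℕ)
    (M : Matrix (x × Fin k) (x × Fin k) ℂ) : Matrix (x × Fin k) (x × Fin k) ℂ :=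
  Matrix.of fun p q => F (Matrix.of fun a b => M (a, p.2) (b, q.2)) p.1 q.1

/-- A quantum channel: a completely positive, trace-preserving linear map. -/
structure IsChannel (F : Matrix x x ℂ →ₗ[ℂ] Matrix x x ℂ) : Prop where
  completelyPositive : ∀ (k : ℕ) (M : Matrix (x × Fin k) (x × Fin k) ℂ),
    M.PosSemidef → (ampliation F k M).PosSemidef
  tracePreserving : ∀ ρ : Matrix x x ℂ, (F ρ).trace = ρ.trace

/-- Covariance with respect to the time evolution generated by `H`. -/
def IsTimeCovariant (H : Matrix x x ℂ) (F : Matrix x x ℂ →ₗ[ℂ] Matrix x x ℂ) : Prop :=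
  ∀ (t : ℝ) (ρ : Matrix x x ℂ),
    F (NormedSpace.exp (-(Complex.I * t) • H) * ρ * NormedSpace.exp ((Complex.I * t) • H)) =
      NormedSpace.exp (-(Complex.I * t) • H) * F ρ * NormedSpace.exp ((Complex.I * t) • H)

/-- The tensor power `F^{⊗ n}`, the linear map whose Choi matrix is the tensor power of that
of `F`. -/
def channelPow (n : ℕ) (F : Matrix x x ℂ →ₗ[ℂ] Matrix x x ℂ) :
    Matrix (Fin n → x) (Fin n → x) ℂ →ₗ[ℂ] Matrix (Fin n → x) (Fin n → x) ℂ :=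
  ofChoi (Matrix.of fun p q => ∏ k, choi F (p.1 k, p.2 k) (q.1 k, q.2 k))

theorem channelPow_tensorFamily (n : ℕ) (F : Matrix x x ℂ →ₗ[ℂ] Matrix x x ℂ)
    (A : Fin n → Matrix x x ℂ) :
    channelPow n F (tensorFamily A) = tensorFamily fun k => F (A k) := by
  ext i j
  have h : ∀ k, F (A k) (i k) (j k)
      = ∑ p : x × x, A k p.1 p.2 * choi F (i k, p.1) (j k, p.2) := by
    intro k
    conv_lhs => rw [← ofChoi_choi F]
    simp [ofChoi, Fintype.sum_prod_type]
  simp only [tensorFamily, Matrix.of_apply, h, Finset.prod_univ_sum, Fintype.piFinset_univ]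
  simp only [channelPow, ofChoi, LinearMap.coe_mk, AddHom.coe_mk, Matrix.of_apply]
  rw [← Fintype.sum_prod_type'
    (f := fun (a b : Fin n → x) => (∏ k, A k (a k) (b k)) *
      ∏ k, choi F (i k, a k) (j k, b k))]
  rw [← (Equiv.arrowProdEquivProdArrow (Fin n) (fun _ => x) (fun _ => x)).sum_comp]
  simp [Finset.prod_mul_distrib]

/-- `V`, acting on `EX`, together with the Hamiltonian `HE` and the state vector `ψ` of `E`
(the vector `|0⟩`) is an energy-conserving Stinespring dilation of the map `F` on `X`. -/
structure IsEnergyConservingDilation (HX : Matrix x x ℂ) (F : Matrix x x ℂ →ₗ[ℂ] Matrix x x ℂ)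
    (HE : Matrix e e ℂ) (ψ : e → ℂ) (V : Matrix (e × x) (e × x) ℂ) : Prop where
  isHermitian : HE.IsHermitian
  normalized : star ψ ⬝ᵥ ψ = 1
  zeroEnergy : star ψ ⬝ᵥ (HE *ᵥ ψ) = 0
  unitary : V ∈ Matrix.unitaryGroup (e × x) ℂ
  energyConserving : V * jointHam HE HX = jointHam HE HX * V
  dilation : ∀ ρ : Matrix x x ℂ, F ρ = traceFst (V * (ketBra ψ ⊗ₖ ρ) * Vᴴ)

end Channels

section WorkCostDephasing

variable {x e : Type*} [Fintype x] [DecidableEq x] [Fintype e] [DecidableEq e]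

/-- The labels `(E, E', lam, mu)`: two energies of a given pair of Hamiltonians and two Young
diagrams. -/
def labels {ι κ : Type*} [Fintype ι] [DecidableEq ι] [Fintype κ] [DecidableEq κ] (n : ℕ)
    (H : Matrix ι ι ℂ) (H' : Matrix κ κ ℂ) :
    Finset (ℝ × ℝ × Nat.Partition n × Nat.Partition n) :=
  energies H ×ˢ energies H' ×ˢ Finset.univ ×ˢ Finset.univ

/-- The difference `(E - S(lam/n)/β) - (E' - S(mu/n)/β)` of the two free energy estimates. -/
def freeEnergyDiff (β : ℝ) {n : ℕ} (l : ℝ × ℝ × Nat.Partition n × Nat.Partition n) : ℝ :=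
  (l.1 - β⁻¹ * shapeEntropy l.2.2.1) - (l.2.1 - β⁻¹ * shapeEntropy l.2.2.2)

/-- The projector `P^(w)` on `EⁿXⁿ`: the sum of `S^{E'} Π_{Xⁿ}^mu Π_{(EX)ⁿ}^lam R^{E}` over all
labels with `E - S(lam/n)/β - E' + S(mu/n)/β = w`, with `R^E` and `S^{E'}` the eigenprojectors of
the total Hamiltonians of `EⁿXⁿ` and `Xⁿ`. -/
def envProj (β : ℝ) (n : ℕ) (HE : Matrix e e ℂ) (HX : Matrix x x ℂ) (w : ℝ) :
    Matrix (Fin n → e × x) (Fin n → e × x) ℂ :=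
  ∑ l ∈ labels n (totalHam n (jointHam HE HX)) (totalHam n HX) with freeEnergyDiff β l = w,
    tensorEnv 1 (energyProj (totalHam n HX) l.2.1) *
      tensorEnv 1 (schurWeylProj x l.2.2.2) *
      schurWeylProj (e × x) l.2.2.1 *
      energyProj (totalHam n (jointHam HE HX)) l.1

/-- The dephasing operation `M ↦ ∑ w, P^(w) M P^(w)` on `EⁿXⁿ`, `w` running over all attained
values. -/
def envDephasing (β : ℝ) (n : ℕ) (HE : Matrix e e ℂ) (HX : Matrix x x ℂ)
    (M : Matrix (Fin n → e × x) (Fin n → e × x) ℂ) :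
    Matrix (Fin n → e × x) (Fin n → e × x) ℂ :=
  ∑ w ∈ (labels n (totalHam n (jointHam HE HX)) (totalHam n HX)).image (freeEnergyDiff β),
    envProj β n HE HX w * M * envProj β n HE HX w

/-- The projector on `XⁿRⁿ` that is the sum of `(S^{E} Π^lam) ⊗ (S^{E'} Π^mu)ᵀ` over all labels
with `E - S(lam/n)/β - E' + S(mu/n)/β = w`: output labels on `Xⁿ`, input labels on `Rⁿ`. -/
def choiProj (β : ℝ) (n : ℕ) (HX : Matrix x x ℂ) (w : ℝ) :
    Matrix ((Fin n → x) × (Fin n → x)) ((Fin n → x) × (Fin n → x)) ℂ :=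
  ∑ l ∈ labels n (totalHam n HX) (totalHam n HX) with freeEnergyDiff β l = w,
    (energyProj (totalHam n HX) l.1 * schurWeylProj x l.2.2.1) ⊗ₖ
      (energyProj (totalHam n HX) l.2.1 * schurWeylProj x l.2.2.2)ᵀ

/-- The work-cost-dephased map of a linear map `F` on the operators of `Xⁿ`: its Choi matrix is
obtained from that of `F` by dephasing with respect to the projectors on `XⁿRⁿ`. -/
def workCostDephased (β : ℝ) (n : ℕ) (HX : Matrix x x ℂ)
    (F : Matrix (Fin n → x) (Fin n → x) ℂ →ₗ[ℂ] Matrix (Fin n → x) (Fin n → x) ℂ) :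
    Matrix (Fin n → x) (Fin n → x) ℂ →ₗ[ℂ] Matrix (Fin n → x) (Fin n → x) ℂ :=
  ofChoi (∑ w ∈ (labels n (totalHam n HX) (totalHam n HX)).image (freeEnergyDiff β),
    choiProj β n HX w * choi F * choiProj β n HX w)

end WorkCostDephasing

end WorkCost

end

/-!
The Schur–Weyl blocks are spanned by the images of Young symmetrizers, and everything rests on two
facts about them.

* *Blocks of different shapes are orthogonal.* For `p ≠ q`, the row sums of tableaux of one shape
  annihilate the alternating column sums of tableaux of the other
  (`stabSum_mul_mul_altSum_eq_zero_or`): otherwise each shape would dominate the other.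
* *The blocks span.* For each shape `p` the sum `shapeSum p` of its Young symmetrizers is central in
  the group algebra and nonzero, and these sums are mutually orthogonal in a faithful
  representation, hence linearly independent. There are as many of them as conjugacy classes of
  permutations, so they span the class functions, and the unit is a combination of Young
  symmetrizers (`one_mem_span_shapeSum`).

Hence the Schur–Weyl projectors resolve the identity, and every matrix that commutes with the
permutations of the copies intertwines the projectors of two systems with the same label
(`schurWeylProj_intertwine`). This applies to `V^{⊗ n}` and to the isometry that adjoins `ψ^{⊗ n}`.

A dephasing `C ↦ ∑ w, P w * C * P w` with `P w = ∑ l with f l = w, Q l` is the sum of the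
`Q l * C * Q l'` over all pairs of labels with `f l = f l'`. For the dilation identity, both sides
are written in this form.

* On the left, covariance of `F` in the infinitesimal form `F [H, ρ] = [H, F ρ]` passes to
  `F^{⊗ n}` and removes the terms that change the difference of the output and input energies.
* On the right, that difference is the energy of the environment, since `H_{EX} - H_X` acts on the
  environment alone, and the partial trace is cyclic for operators on the environment. So the same
  terms vanish, and `ψ` need not be an eigenvector of `HE`.

Among the remaining terms the condition `f l = f l'` concerns only the entropies of the shapes, the
energy projectors sum to the identity (`sum_labels_of_energy_conserving`), and both sides become the
same sum over shapes.

For the channel property, the dephased Choi matrix is a sum of Hermitian sandwiches of a positive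
semidefinite matrix, which gives complete positivity. Under the trace, the two output labels of a
term have to agree, so that the two input labels have equal free energies, and trace preservation
of the given channel together with completeness of the projectors does the rest.
-/

noncomputable section

namespace WorkCost

set_option linter.unusedSectionVars false

/-! ### Dominance of Young diagrams -/

section Dominance

theorem card_cellsOfRowLens (w : List ℕ) :
    (YoungDiagram.cellsOfRowLens w).card = w.sum := by
  induction w with
  | nil => simp [YoungDiagram.cellsOfRowLens]
  | cons a w ih =>
    rw [YoungDiagram.cellsOfRowLens, Finset.card_union_of_disjoint]
    · simp [ih]
    · rw [Finset.disjoint_left]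
      rintro ⟨i, j⟩ h
      simp only [Finset.mem_product, Finset.mem_singleton] at h
      simp [h.1]

theorem card_cells_diagram {n : ℕ} (p : Nat.Partition n) : (diagram p).cells.card = n := by
  have h := card_cellsOfRowLens (p.parts.sort (· ≥ ·))
  rw [← Multiset.sum_coe, Multiset.sort_eq, p.parts_sum] at h
  exact h

instance {n : ℕ} (p : Nat.Partition n) : Nonempty (Tableau p) :=
  ⟨Fintype.equivOfCardEq (by simp [card_cells_diagram])⟩

theorem diagram_injective {n : ℕ} :
    Function.Injective (diagram : Nat.Partition n → YoungDiagram) := by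
  intro p q h
  have key : ∀ p : Nat.Partition n, (diagram p).rowLens = p.parts.sort (· ≥ ·) := fun p =>
    YoungDiagram.rowLens_ofRowLens_eq_self fun x hx => p.parts_pos (by simpa using hx)
  have h2 := key p
  rw [h, key q] at h2
  ext1
  rw [← Multiset.sort_eq p.parts (· ≥ ·), ← Multiset.sort_eq q.parts (· ≥ ·), h2]

/-- The cells of a Young diagram in its first `k` rows. -/
def topCells (μ : YoungDiagram) (k : ℕ) : Finset (ℕ × ℕ) := μ.cells.filter fun c => c.1 < k

theorem card_topCells_succ (μ : YoungDiagram) (k : ℕ) :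
    (topCells μ (k + 1)).card = (topCells μ k).card + μ.rowLen k := by
  rw [YoungDiagram.rowLen_eq_card, ← Finset.card_union_of_disjoint]
  · congr 1
    ext c
    simp only [topCells, YoungDiagram.row, Finset.mem_union, Finset.mem_filter, ← and_or_left]
    rw [Nat.lt_succ_iff, Nat.le_iff_lt_or_eq]
  · rw [Finset.disjoint_left]
    intro c hc hc'
    simp only [topCells, YoungDiagram.row, Finset.mem_filter] at hc hc'
    omega

theorem eq_of_card_topCells_eq {μ ν : YoungDiagram}
    (h : ∀ k, (topCells μ k).card = (topCells ν k).card) : μ = ν := by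
  have hr : ∀ k, μ.rowLen k = ν.rowLen k := fun k => by
    have h1 := h (k + 1)
    rw [card_topCells_succ, card_topCells_succ, h k] at h1
    omega
  ext ⟨i, j⟩
  rw [YoungDiagram.mem_cells, YoungDiagram.mem_cells, YoungDiagram.mem_iff_lt_rowLen,
    YoungDiagram.mem_iff_lt_rowLen, hr]

/-- The dominance lemma: if no two entries share both a row of `T` and a column of `T'`, the shape
of `T'` dominates that of `T`, because each column of `T'` holds at most `k` of the entries in the
first `k` rows of `T`. -/
theorem card_topCells_le_of_separated {α : Type*} [Fintype α] {μ ν : YoungDiagram}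
    (T : α ≃ μ.cells) (T' : α ≃ ν.cells)
    (h : ∀ i j, (T i).1.1 = (T j).1.1 → (T' i).1.2 = (T' j).1.2 → i = j) (k : ℕ) :
    (topCells μ k).card ≤ (topCells ν k).card := by
  classical
  set S : Finset α := Finset.univ.filter fun i => (T i).1.1 < k with hS
  have h1 : (topCells μ k).card = S.card := by
    symm
    refine Finset.card_bij (fun i _ => (T i).1) ?_ ?_ ?_
    · intro i hi
      simp only [hS, Finset.mem_filter, Finset.mem_univ, true_and] at hi
      exact Finset.mem_filter.2 ⟨(T i).2, hi⟩
    · intro i _ j _ hij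
      exact T.injective (Subtype.ext hij)
    · intro c hc
      obtain ⟨hc1, hc2⟩ := Finset.mem_filter.1 hc
      exact ⟨T.symm ⟨c, hc1⟩, by simpa [hS] using hc2, by simp⟩
  rw [h1, Finset.card_eq_sum_card_fiberwise (f := fun i => (T' i).1.2)
      (t := ν.cells.image Prod.snd) fun i _ => by
        simpa using ⟨_, (T' i).2⟩,
    Finset.card_eq_sum_card_fiberwise (s := topCells ν k) (f := Prod.snd)
      (t := ν.cells.image Prod.snd) fun c hc =>
        Finset.mem_coe.2 (Finset.mem_image_of_mem _ (Finset.mem_filter.1 hc).1)]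
  refine Finset.sum_le_sum fun j _ => ?_
  have h2 : (topCells ν k).filter (fun c => c.2 = j)
      = Finset.range (min k (ν.colLen j)) ×ˢ {j} := by
    ext ⟨a, b⟩
    simp only [topCells, Finset.mem_filter, YoungDiagram.mem_cells, Finset.mem_product,
      Finset.mem_range, Finset.mem_singleton, lt_min_iff, YoungDiagram.mem_iff_lt_colLen]
    constructor
    · rintro ⟨⟨h, h'⟩, rfl⟩; exact ⟨⟨h', h⟩, rfl⟩
    · rintro ⟨⟨h', h⟩, rfl⟩; exact ⟨⟨h, h'⟩, rfl⟩
  rw [h2, Finset.card_product, Finset.card_range, Finset.card_singleton, mul_one, le_min_iff]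
  constructor
  · calc _ ≤ (Finset.range k).card := by
          refine Finset.card_le_card_of_injOn (fun i => (T i).1.1) ?_ ?_
          · intro i hi
            simpa [hS] using (Finset.mem_filter.1 (Finset.mem_filter.1 hi).1).2
          · intro i hi i' hi' hii
            exact h i i' hii ((Finset.mem_filter.1 hi).2.trans (Finset.mem_filter.1 hi').2.symm)
      _ = k := Finset.card_range k
  · rw [YoungDiagram.colLen_eq_card]
    refine Finset.card_le_card_of_injOn (fun i => (T' i).1) ?_ ?_
    · intro i hi
      exact Finset.mem_coe.2 (YoungDiagram.mem_col_iff.2 ⟨(T' i).2, (Finset.mem_filter.1 hi).2⟩)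
    · intro i _ i' _ hii
      exact T'.injective (Subtype.ext hii)

end Dominance

/-! ### Young symmetrizers -/

section YoungSymmetrizers

variable {n : ℕ}

local notation "𝔸" => MonoidAlgebra ℂ (Equiv.Perm (Fin n))

open Classical in
/-- The sum of the permutations that preserve the labelling `f`. -/
def stabSum (f : Fin n → ℕ) : 𝔸 :=
  ∑ σ : Equiv.Perm (Fin n) with ∀ i, f (σ i) = f i, MonoidAlgebra.of ℂ (Equiv.Perm (Fin n)) σ

open Classical in
/-- The signed sum of the permutations that preserve the labelling `f`. -/
def altSum (f : Fin n → ℕ) : 𝔸 :=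
  ∑ τ : Equiv.Perm (Fin n) with ∀ i, f (τ i) = f i,
    ((Equiv.Perm.sign τ : ℤ) : ℂ) • MonoidAlgebra.of ℂ (Equiv.Perm (Fin n)) τ

/-- The row index of each entry of a tableau. -/
def rowIndex {p : Nat.Partition n} (T : Tableau p) (i : Fin n) : ℕ := (T i).1.1

/-- The column index of each entry of a tableau. -/
def colIndex {p : Nat.Partition n} (T : Tableau p) (i : Fin n) : ℕ := (T i).1.2

theorem youngSymmetrizer_eq {p : Nat.Partition n} (T : Tableau p) :
    youngSymmetrizer T = stabSum (rowIndex T) * altSum (colIndex T) := rfl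

theorem of_mul_stabSum (σ : Equiv.Perm (Fin n)) (f : Fin n → ℕ) :
    MonoidAlgebra.of ℂ _ σ * stabSum f = stabSum (f ∘ ⇑σ⁻¹) * MonoidAlgebra.of ℂ _ σ := by
  classical
  rw [stabSum, stabSum, Finset.mul_sum, Finset.sum_mul]
  refine Finset.sum_bij' (fun τ _ => σ * τ * σ⁻¹) (fun τ _ => σ⁻¹ * τ * σ) ?_ ?_ ?_ ?_ ?_
  · intro τ hτ
    simp only [Finset.mem_filter, Finset.mem_univ, true_and] at hτ ⊢
    intro i
    simp [hτ]
  · intro τ hτ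
    simp only [Finset.mem_filter, Finset.mem_univ, true_and] at hτ ⊢
    intro i
    simpa using hτ (σ i)
  · intro τ _; group
  · intro τ _; group
  · intro τ _
    rw [← map_mul, ← map_mul]
    congr 1
    group

theorem of_mul_altSum (σ : Equiv.Perm (Fin n)) (f : Fin n → ℕ) :
    MonoidAlgebra.of ℂ _ σ * altSum f = altSum (f ∘ ⇑σ⁻¹) * MonoidAlgebra.of ℂ _ σ := by
  classical
  rw [altSum, altSum, Finset.mul_sum, Finset.sum_mul]
  refine Finset.sum_bij' (fun τ _ => σ * τ * σ⁻¹) (fun τ _ => σ⁻¹ * τ * σ) ?_ ?_ ?_ ?_ ?_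
  · intro τ hτ
    simp only [Finset.mem_filter, Finset.mem_univ, true_and] at hτ ⊢
    intro i
    simp [hτ]
  · intro τ hτ
    simp only [Finset.mem_filter, Finset.mem_univ, true_and] at hτ ⊢
    intro i
    simpa using hτ (σ i)
  · intro τ _; group
  · intro τ _; group
  · intro τ _
    have hs : Equiv.Perm.sign (σ * τ * σ⁻¹) = Equiv.Perm.sign τ := by
      rw [map_mul, map_mul, map_inv, mul_right_comm, mul_inv_cancel, one_mul]
    rw [hs, mul_smul_comm, smul_mul_assoc, ← map_mul, ← map_mul]
    congr 2
    group

theorem stabSum_mul_of_swap {f : Fin n → ℕ} {i j : Fin n} (h : f i = f j) :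
    stabSum f * MonoidAlgebra.of ℂ _ (Equiv.swap i j) = stabSum f := by
  classical
  have hf : ∀ k, f (Equiv.swap i j k) = f k := fun k => by
    rw [Equiv.swap_apply_def]; split_ifs with h1 h2 <;> simp_all
  rw [stabSum, Finset.sum_mul]
  refine Finset.sum_bij' (fun τ _ => τ * Equiv.swap i j) (fun τ _ => τ * Equiv.swap i j)
    ?_ ?_ ?_ ?_ ?_
  · intro τ hτ
    simp only [Finset.mem_filter, Finset.mem_univ, true_and] at hτ ⊢
    intro k; simp [hτ, hf]
  · intro τ hτ
    simp only [Finset.mem_filter, Finset.mem_univ, true_and] at hτ ⊢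
    intro k; simp [hτ, hf]
  · intro τ _; simp [mul_assoc]
  · intro τ _; simp [mul_assoc]
  · intro τ _; rw [map_mul]

theorem of_swap_mul_altSum {f : Fin n → ℕ} {i j : Fin n} (hij : i ≠ j) (h : f i = f j) :
    MonoidAlgebra.of ℂ _ (Equiv.swap i j) * altSum f = -altSum f := by
  classical
  have hf : ∀ k, f (Equiv.swap i j k) = f k := fun k => by
    rw [Equiv.swap_apply_def]; split_ifs with h1 h2 <;> simp_all
  rw [altSum, Finset.mul_sum, ← Finset.sum_neg_distrib]
  refine Finset.sum_bij' (fun τ _ => Equiv.swap i j * τ) (fun τ _ => Equiv.swap i j * τ)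
    ?_ ?_ ?_ ?_ ?_
  · intro τ hτ
    simp only [Finset.mem_filter, Finset.mem_univ, true_and] at hτ ⊢
    intro k; simp [hτ, hf]
  · intro τ hτ
    simp only [Finset.mem_filter, Finset.mem_univ, true_and] at hτ ⊢
    intro k; simp [hτ, hf]
  · intro τ _; simp
  · intro τ _; simp
  · intro τ _
    rw [mul_smul_comm, ← map_mul]
    simp [Equiv.Perm.sign_swap hij]

/-- If a transposition preserves both labellings, it can be absorbed on either side of the product,
once with the sign `+` and once with the sign `-`. -/
theorem stabSum_mul_altSum_eq_zero {f g : Fin n → ℕ} {i j : Fin n} (hij : i ≠ j)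
    (hf : f i = f j) (hg : g i = g j) : stabSum f * altSum g = 0 := by
  have h : stabSum f * altSum g = -(stabSum f * altSum g) := by
    conv_lhs => rw [← stabSum_mul_of_swap hf, mul_assoc, of_swap_mul_altSum hij hg, mul_neg]
  have h2 : (2 : ℂ) • (stabSum f * altSum g) = 0 := by
    rw [two_smul]
    nth_rewrite 2 [h]
    exact add_neg_cancel _
  exact (smul_eq_zero.1 h2).resolve_left two_ne_zero

theorem exists_separated_of_ne_zero {f g : Fin n → ℕ} {x : 𝔸}
    (h : stabSum f * x * altSum g ≠ 0) :
    ∃ σ : Equiv.Perm (Fin n), ∀ i j, f i = f j → g (σ⁻¹ i) = g (σ⁻¹ j) → i = j := by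
  by_contra! hs
  refine h ?_
  induction x using MonoidAlgebra.induction_on with
  | of σ =>
    obtain ⟨i, j, hf, hg, hij⟩ := hs σ
    rw [mul_assoc, of_mul_altSum, ← mul_assoc,
      stabSum_mul_altSum_eq_zero hij hf (by simpa using hg), zero_mul]
  | add a b ha hb =>
    have ha' : stabSum f * a * altSum g = 0 := by by_contra h0; exact h0 (ha h0)
    have hb' : stabSum f * b * altSum g = 0 := by by_contra h0; exact h0 (hb h0)
    rw [mul_add, add_mul, ha', hb', add_zero]
  | smul r a ha =>
    have ha' : stabSum f * a * altSum g = 0 := by by_contra h0; exact h0 (ha h0)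
    rw [mul_smul_comm, smul_mul_assoc, ha', smul_zero]

theorem card_topCells_le_of_ne_zero {p q : Nat.Partition n} {T : Tableau p} {T' : Tableau q}
    {x : 𝔸} (h : stabSum (rowIndex T) * x * altSum (colIndex T') ≠ 0) (k : ℕ) :
    (topCells (diagram p) k).card ≤ (topCells (diagram q) k).card := by
  obtain ⟨σ, hσ⟩ := exists_separated_of_ne_zero h
  exact card_topCells_le_of_separated T (σ.symm.trans T') hσ k

/-- For two different shapes, the row sums of one annihilate the alternating column sums of the
other, since dominance is antisymmetric. -/
theorem stabSum_mul_mul_altSum_eq_zero_or {p q : Nat.Partition n} (hpq : p ≠ q) :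
    (∀ (T : Tableau p) (T' : Tableau q) (x : 𝔸),
      stabSum (rowIndex T) * x * altSum (colIndex T') = 0) ∨
    (∀ (T : Tableau p) (T' : Tableau q) (x : 𝔸),
      stabSum (rowIndex T') * x * altSum (colIndex T) = 0) := by
  by_contra! h
  obtain ⟨⟨T, T', x, hx⟩, S, S', y, hy⟩ := h
  exact hpq (diagram_injective (eq_of_card_topCells_eq fun k =>
    le_antisymm (card_topCells_le_of_ne_zero hx k) (card_topCells_le_of_ne_zero hy k)))

theorem of_mul_youngSymmetrizer {p : Nat.Partition n} (σ : Equiv.Perm (Fin n)) (T : Tableau p) :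
    MonoidAlgebra.of ℂ _ σ * youngSymmetrizer T
      = youngSymmetrizer (σ.symm.trans T : Tableau p) * MonoidAlgebra.of ℂ _ σ := by
  rw [youngSymmetrizer_eq, ← mul_assoc, of_mul_stabSum, mul_assoc, of_mul_altSum, ← mul_assoc]
  rfl

/-- The only permutation preserving all rows and all columns is the identity, so the coefficient
of a Young symmetrizer at the identity is `1`. -/
theorem youngSymmetrizer_coeff_one {p : Nat.Partition n} (T : Tableau p) :
    (youngSymmetrizer T).coeff 1 = 1 := by
  classical
  rw [youngSymmetrizer_eq, stabSum, altSum, Finset.sum_mul_sum]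
  simp only [MonoidAlgebra.coeff_sum, Finsupp.finsetSum_apply]
  rw [Finset.sum_eq_single 1, Finset.sum_eq_single 1]
  · simp [MonoidAlgebra.of_apply]
  · intro τ _ hτ
    simp [MonoidAlgebra.of_apply, MonoidAlgebra.single_mul_single, hτ]
  · simp
  · intro σ hσ hσ1
    refine Finset.sum_eq_zero fun τ hτ => ?_
    have h : σ * τ ≠ 1 := by
      intro h
      have hτσ : τ = σ⁻¹ := eq_inv_of_mul_eq_one_right h
      subst hτσ
      simp only [Finset.mem_filter, Finset.mem_univ, true_and] at hσ hτ
      refine hσ1 (Equiv.ext fun i => T.injective (Subtype.ext (Prod.ext (hσ i) ?_)))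
      have h1 := hτ (σ i)
      rw [Equiv.Perm.inv_def, Equiv.symm_apply_apply] at h1
      exact h1.symm
    simp [MonoidAlgebra.of_apply, MonoidAlgebra.single_mul_single, h]
  · simp

open Classical in
/-- The sum of the Young symmetrizers of all tableaux of shape `p`, a central element of the group
algebra. -/
def shapeSum (p : Nat.Partition n) : 𝔸 := ∑ T : Tableau p, youngSymmetrizer T

theorem of_mul_shapeSum (σ : Equiv.Perm (Fin n)) (p : Nat.Partition n) :
    MonoidAlgebra.of ℂ _ σ * shapeSum p = shapeSum p * MonoidAlgebra.of ℂ _ σ := by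
  classical
  rw [shapeSum, Finset.mul_sum, Finset.sum_mul]
  refine Fintype.sum_equiv (Equiv.equivCongr σ (Equiv.refl _)) _ _ fun T => ?_
  rw [of_mul_youngSymmetrizer]
  rfl

theorem shapeSum_coeff_conj (p : Nat.Partition n) (σ τ : Equiv.Perm (Fin n)) :
    (shapeSum p).coeff (σ * τ * σ⁻¹) = (shapeSum p).coeff τ := by
  have h := congrArg (fun x : 𝔸 => x.coeff (σ * τ)) (of_mul_shapeSum σ p)
  simpa [MonoidAlgebra.of_apply] using h.symm

theorem shapeSum_coeff_one_ne_zero (p : Nat.Partition n) : (shapeSum p).coeff 1 ≠ 0 := by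
  classical
  rw [shapeSum, MonoidAlgebra.coeff_sum, Finsupp.finsetSum_apply]
  simp [youngSymmetrizer_coeff_one]

variable {d : Type*} [Fintype d] [DecidableEq d]

theorem permAlgRep_of (σ : Equiv.Perm (Fin n)) :
    permAlgRep n d (MonoidAlgebra.of ℂ _ σ) = permRep n d σ := by
  simp [permAlgRep]

theorem conjTranspose_permRep (σ : Equiv.Perm (Fin n)) :
    (permRep n d σ)ᴴ = permRep n d σ⁻¹ := by
  ext a b
  simp only [permRep, MonoidHom.coe_mk, OneHom.coe_mk, Matrix.conjTranspose_apply,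
    Matrix.of_apply, inv_inv]
  have : b = a ∘ ⇑σ⁻¹ ↔ a = b ∘ ⇑σ := by
    constructor <;> (rintro rfl; ext i; simp)
  by_cases h : a = b ∘ ⇑σ
  · rw [if_pos h, if_pos (this.2 h), star_one]
  · rw [if_neg h, if_neg (fun h' => h (this.1 h')), star_zero]

theorem conjTranspose_stabSum (f : Fin n → ℕ) :
    (permAlgRep n d (stabSum f))ᴴ = permAlgRep n d (stabSum f) := by
  classical
  simp only [stabSum, map_sum, Matrix.conjTranspose_sum, permAlgRep_of, conjTranspose_permRep]
  refine Finset.sum_bij' (fun τ _ => τ⁻¹) (fun τ _ => τ⁻¹) ?_ ?_ ?_ ?_ ?_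
  · intro τ hτ
    simp only [Finset.mem_filter, Finset.mem_univ, true_and] at hτ ⊢
    intro i; simpa using (hτ (τ⁻¹ i)).symm
  · intro τ hτ
    simp only [Finset.mem_filter, Finset.mem_univ, true_and] at hτ ⊢
    intro i; simpa using (hτ (τ⁻¹ i)).symm
  all_goals simp

theorem conjTranspose_altSum (f : Fin n → ℕ) :
    (permAlgRep n d (altSum f))ᴴ = permAlgRep n d (altSum f) := by
  classical
  simp only [altSum, map_sum, map_smul, Matrix.conjTranspose_sum, Matrix.conjTranspose_smul,
    permAlgRep_of, conjTranspose_permRep]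
  refine Finset.sum_bij' (fun τ _ => τ⁻¹) (fun τ _ => τ⁻¹) ?_ ?_ ?_ ?_ ?_
  · intro τ hτ
    simp only [Finset.mem_filter, Finset.mem_univ, true_and] at hτ ⊢
    intro i; simpa using (hτ (τ⁻¹ i)).symm
  · intro τ hτ
    simp only [Finset.mem_filter, Finset.mem_univ, true_and] at hτ ⊢
    intro i; simpa using (hτ (τ⁻¹ i)).symm
  all_goals simp

/-- Young symmetrizers of different shapes have orthogonal ranges. -/
theorem conjTranspose_youngSymmetrizer_mul_eq_zero {p q : Nat.Partition n} (hpq : p ≠ q)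
    (T : Tableau p) (T' : Tableau q) :
    (permAlgRep n d (youngSymmetrizer T))ᴴ * permAlgRep n d (youngSymmetrizer T') = 0 := by
  -- It suffices to treat one of the two orders of the shapes; the other one is its adjoint.
  have key : ∀ {p q : Nat.Partition n} (T : Tableau p) (T' : Tableau q),
      stabSum (rowIndex T) * stabSum (rowIndex T') * altSum (colIndex T') = 0 →
      (permAlgRep n d (youngSymmetrizer T))ᴴ * permAlgRep n d (youngSymmetrizer T') = 0 := by
    intro p q T T' h
    rw [youngSymmetrizer_eq, youngSymmetrizer_eq, map_mul, Matrix.conjTranspose_mul,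
      conjTranspose_altSum, conjTranspose_stabSum, ← map_mul, ← map_mul, mul_assoc,
      ← mul_assoc (stabSum (rowIndex T)), h, mul_zero, map_zero]
  rcases stabSum_mul_mul_altSum_eq_zero_or hpq with h | h
  · exact key T T' (h T T' _)
  · have h' := congrArg Matrix.conjTranspose (key T' T (h T T' _))
    simpa using h'

theorem permAlgRep_apply_id (x : 𝔸) :
    permAlgRep n (Fin n) x id id = x.coeff 1 := by
  induction x using MonoidAlgebra.induction_on with
  | of σ =>
    rw [permAlgRep_of, MonoidAlgebra.of_apply, MonoidAlgebra.coeff_single, Finsupp.single_apply]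
    simp only [permRep, MonoidHom.coe_mk, OneHom.coe_mk, Matrix.of_apply, Function.id_comp]
    refine if_congr ⟨fun h => ?_, fun h => by subst h; rfl⟩ rfl rfl
    rw [← inv_eq_one]
    exact Equiv.ext fun i => (congrFun h i).symm
  | add a b ha hb => simp [ha, hb]
  | smul r a ha => simp [ha]

theorem linearIndependent_shapeSum :
    LinearIndependent ℂ (shapeSum : Nat.Partition n → 𝔸) := by
  classical
  rw [Fintype.linearIndependent_iff]
  intro a ha q
  -- On `n` copies of an `n`-level system the group algebra acts faithfully.
  set M : Nat.Partition n → Matrix (Fin n → Fin n) (Fin n → Fin n) ℂ :=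
    fun p => permAlgRep n (Fin n) (shapeSum p) with hM
  have horth : ∀ p, p ≠ q → (M q)ᴴ * M p = 0 := by
    intro p hp
    simp only [hM, shapeSum, map_sum, Matrix.conjTranspose_sum, Finset.sum_mul_sum]
    exact Finset.sum_eq_zero fun T _ => Finset.sum_eq_zero fun T' _ =>
      conjTranspose_youngSymmetrizer_mul_eq_zero hp.symm T T'
  have h1 : ∑ p, a p • M p = 0 := by
    have := congrArg (permAlgRep n (Fin n)) ha
    simpa only [map_sum, map_smul, map_zero] using this
  have h2 := congrArg (fun N => (M q)ᴴ * N) h1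
  simp only [Finset.mul_sum, mul_smul_comm, mul_zero] at h2
  rw [Finset.sum_eq_single q (fun p _ hp => by rw [horth p hp, smul_zero]) (by simp)] at h2
  refine (smul_eq_zero.1 h2).resolve_right fun h3 => ?_
  have h4 := congrFun₂ (Matrix.conjTranspose_mul_self_eq_zero.1 h3) id id
  simp only [hM, permAlgRep_apply_id] at h4
  exact shapeSum_coeff_one_ne_zero q h4

/-- The unit of the group algebra is a combination of the `shapeSum p`: they are linearly
independent class functions, and there are as many of them as conjugacy classes. -/
theorem one_mem_span_shapeSum :
    (1 : 𝔸) ∈ Submodule.span ℂ (Set.range (shapeSum : Nat.Partition n → 𝔸)) := by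
  classical
  let L : (Nat.Partition (Fintype.card (Fin n)) → ℂ) →ₗ[ℂ] 𝔸 :=
    ∑ σ : Equiv.Perm (Fin n),
      (LinearMap.proj σ.partition).smulRight (MonoidAlgebra.of ℂ (Equiv.Perm (Fin n)) σ)
  -- Class functions factor through the cycle type.
  have hL : ∀ z : 𝔸, (∀ σ τ, z.coeff (σ * τ * σ⁻¹) = z.coeff τ) → ∃ f, L f = z := by
    intro z hz
    have hfac : Function.FactorsThrough (fun σ => z.coeff σ)
        (Equiv.Perm.partition : Equiv.Perm (Fin n) → _) := by
      intro σ τ h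
      obtain ⟨c, hc⟩ := isConj_iff.1 (Equiv.Perm.partition_eq_of_isConj.2 h)
      change z.coeff σ = z.coeff τ
      rw [← hc, hz]
    refine ⟨Function.extend Equiv.Perm.partition (fun σ => z.coeff σ) 0, ?_⟩
    ext τ
    simp only [L, LinearMap.sum_apply, LinearMap.smulRight_apply, LinearMap.proj_apply,
      hfac.extend_apply, MonoidAlgebra.coeff_sum, Finsupp.finsetSum_apply, MonoidAlgebra.of_apply,
      MonoidAlgebra.smul_single, smul_eq_mul, mul_one, MonoidAlgebra.coeff_single]
    simp [Finsupp.single_apply]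
  choose f hf using fun p : Nat.Partition n => hL (shapeSum p) (shapeSum_coeff_conj p)
  have hli : LinearIndependent ℂ f := by
    apply LinearIndependent.of_comp L
    have : (⇑L ∘ f) = shapeSum := funext hf
    rw [this]
    exact linearIndependent_shapeSum
  have hspan : Submodule.span ℂ (Set.range f) = ⊤ :=
    hli.span_eq_top_of_card_eq_finrank' (by simp)
  obtain ⟨g, hg⟩ := hL 1 fun σ τ => by
    simp only [MonoidAlgebra.one_def, MonoidAlgebra.coeff_single, Finsupp.single_apply]
    refine if_congr ⟨fun h => ?_, fun h => by subst h; simp⟩ rfl rfl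
    simpa [eq_comm] using h
  rw [← hg]
  have hfun : (shapeSum : Nat.Partition n → 𝔸) = ⇑L ∘ f := (funext hf).symm
  rw [hfun, Set.range_comp, ← Submodule.map_span, hspan]
  exact Submodule.mem_map_of_mem trivial

end YoungSymmetrizers

/-! ### Resolutions of the identity -/

section Resolutions

variable {ι κ : Type*} [Fintype ι] [DecidableEq ι] [Fintype κ] [DecidableEq κ]

theorem toEuclideanLin_mul {m l : Type*} [Fintype l] [DecidableEq l] (A : Matrix m κ ℂ)
    (B : Matrix κ l ℂ) :
    Matrix.toEuclideanLin (A * B) = Matrix.toEuclideanLin A ∘ₗ Matrix.toEuclideanLin B :=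
  Matrix.toLpLin_mul _ _ _ _ _

theorem toEuclideanLin_projMatrix (K : Submodule ℂ (EuclideanSpace ℂ ι)) :
    Matrix.toEuclideanLin (projMatrix K) = (K.starProjection : _ →ₗ[ℂ] _) :=
  LinearEquiv.apply_symm_apply _ _

theorem isHermitian_projMatrix (K : Submodule ℂ (EuclideanSpace ℂ ι)) :
    (projMatrix K).IsHermitian := by
  rw [← Matrix.isSymmetric_toEuclideanLin_iff, toEuclideanLin_projMatrix]
  exact K.starProjection_isSymmetric

theorem projMatrix_mul_of_range_le {K : Submodule ℂ (EuclideanSpace ℂ ι)} {A : Matrix ι κ ℂ}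
    (h : ∀ v, Matrix.toEuclideanLin A v ∈ K) : projMatrix K * A = A := by
  apply Matrix.toEuclideanLin.injective
  rw [toEuclideanLin_mul, toEuclideanLin_projMatrix]
  ext1 v
  exact Submodule.starProjection_eq_self_iff.2 (h v)

theorem toEuclideanLin_projMatrix_mem (K : Submodule ℂ (EuclideanSpace ℂ ι)) (v) :
    Matrix.toEuclideanLin (projMatrix K) v ∈ K := by
  rw [toEuclideanLin_projMatrix]
  exact K.starProjection_apply_mem v

theorem projMatrix_mul_projMatrix_of_isOrtho {K L : Submodule ℂ (EuclideanSpace ℂ ι)}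
    (h : K ⟂ L) : projMatrix K * projMatrix L = 0 := by
  apply Matrix.toEuclideanLin.injective
  rw [toEuclideanLin_mul, toEuclideanLin_projMatrix, toEuclideanLin_projMatrix, map_zero]
  ext1 v
  refine (K.starProjection_apply_eq_zero_iff).2 ?_
  exact h.symm (L.starProjection_apply_mem v)

/-- A family of matrices that are pairwise orthogonal orthogonal projections, those with index in
the finite set `s` summing to the identity. -/
structure IsResolution {I : Type*} (s : Finset I) (P : I → Matrix ι ι ℂ) : Prop where
  isHermitian : ∀ i, (P i).IsHermitian
  mul_self : ∀ i, P i * P i = P i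
  mul_of_ne : ∀ i j, i ≠ j → P i * P j = 0
  sum_eq_one : ∑ i ∈ s, P i = 1

theorem isResolution_projMatrix {I : Type*} {s : Finset I}
    {K : I → Submodule ℂ (EuclideanSpace ℂ ι)} (horth : ∀ i j, i ≠ j → K i ⟂ K j)
    (htop : ⨆ i ∈ s, K i = ⊤) : IsResolution s fun i => projMatrix (K i) where
  isHermitian i := isHermitian_projMatrix _
  mul_self i := projMatrix_mul_of_range_le (toEuclideanLin_projMatrix_mem _)
  mul_of_ne i j hij := projMatrix_mul_projMatrix_of_isOrtho (horth i j hij)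
  sum_eq_one := by
    classical
    -- Both sides agree on every `K j` with `j ∈ s`, and these subspaces span.
    have h : ∀ j ∈ s, K j ≤ LinearMap.eqLocus
        (Matrix.toEuclideanLin (∑ i ∈ s, projMatrix (K i))) LinearMap.id := by
      intro j hj v hv
      rw [LinearMap.mem_eqLocus, map_sum, LinearMap.sum_apply, Finset.sum_eq_single j]
      · rw [toEuclideanLin_projMatrix]
        exact Submodule.starProjection_eq_self_iff.2 hv
      · intro i _ hij
        rw [toEuclideanLin_projMatrix]
        exact ((K i).starProjection_apply_eq_zero_iff).2 ((horth i j hij).symm hv)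
      · exact fun h => absurd hj h
    apply Matrix.toEuclideanLin.injective
    have h2 : (1 : Matrix ι ι ℂ).toEuclideanLin = LinearMap.id := Matrix.toLpLin_one _
    rw [h2]
    exact LinearMap.eqLocus_eq_top.1 (top_le_iff.1 (htop ▸ iSup₂_le h))

theorem IsResolution.eq_zero_of_notMem {I : Type*} {s : Finset I} {P : I → Matrix ι ι ℂ}
    (hP : IsResolution s P) {i : I} (hi : i ∉ s) : P i = 0 := by
  rw [← mul_one (P i), ← hP.sum_eq_one, Finset.mul_sum]
  exact Finset.sum_eq_zero fun j hj => hP.mul_of_ne i j fun h => hi (h ▸ hj)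

/-- A matrix that maps each range of one resolution to the corresponding range of another one
intertwines the projections. -/
theorem IsResolution.intertwine {I : Type*} {s t : Finset I} {P : I → Matrix ι ι ℂ}
    {Q : I → Matrix κ κ ℂ} (hP : IsResolution s P) (hQ : IsResolution t Q) {A : Matrix ι κ ℂ}
    (h : ∀ i, P i * (A * Q i) = A * Q i) (i : I) : P i * A = A * Q i := by
  classical
  have h1 : ∀ j, j ≠ i → P i * (A * Q j) = 0 := fun j hj => by
    rw [← h j, ← Matrix.mul_assoc, hP.mul_of_ne i j hj.symm, Matrix.zero_mul]
  calc P i * A = ∑ j ∈ t, P i * (A * Q j) := by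
        rw [← Matrix.mul_sum, ← Matrix.mul_sum, hQ.sum_eq_one, Matrix.mul_one]
    _ = P i * (A * Q i) := by
        refine Finset.sum_eq_single i (fun j _ hj => h1 j hj) fun hi => ?_
        rw [hQ.eq_zero_of_notMem hi, Matrix.mul_zero, Matrix.mul_zero]
    _ = A * Q i := h i

end Resolutions

/-! ### Energy projectors -/

section EnergyProjectors

variable {ι κ : Type*} [Fintype ι] [DecidableEq ι] [Fintype κ] [DecidableEq κ]

theorem mul_energyProj (H : Matrix ι ι ℂ) (E : ℝ) :
    H * energyProj H E = (E : ℂ) • energyProj H E := by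
  apply Matrix.toEuclideanLin.injective
  rw [toEuclideanLin_mul, map_smul]
  ext1 v
  exact Module.End.mem_eigenspace_iff.1 (toEuclideanLin_projMatrix_mem
    (Module.End.eigenspace (Matrix.toEuclideanLin H) (E : ℂ)) v)

theorem isResolution_energyProj {H : Matrix ι ι ℂ} (hH : H.IsHermitian) :
    IsResolution (energies H) (energyProj H) := by
  have hs : (Matrix.toEuclideanLin H).IsSymmetric := Matrix.isSymmetric_toEuclideanLin_iff.2 hH
  refine isResolution_projMatrix (fun E E' hE => ?_) ?_
  · exact hs.orthogonalFamily_eigenspaces.isOrtho (by exact_mod_cast hE)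
  · rw [eq_top_iff, ← Submodule.orthogonal_eq_bot_iff.1 hs.orthogonalComplement_iSup_eigenspaces_eq_bot]
    refine iSup_le fun z => ?_
    by_cases hz : Module.End.eigenspace (Matrix.toEuclideanLin H) z = ⊥
    · rw [hz]; exact bot_le
    have hev : Module.End.HasEigenvalue (Matrix.toEuclideanLin H) z := hz
    have hre : ((z.re : ℝ) : ℂ) = z := by
      exact Complex.conj_eq_iff_re.1 (hs.conj_eigenvalue_eq_self hev)
    have hmem : z.re ∈ energies H := by
      rw [energies, Set.Finite.mem_toFinset]
      have h1 : z ∈ spectrum ℂ H := by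
        rw [← Matrix.spectrum_toLpLin 2]
        exact hev.mem_spectrum
      rw [← hre] at h1
      exact (spectrum.algebraMap_mem_iff ℂ).1 h1
    refine le_trans (le_of_eq ?_) (le_iSup₂_of_le z.re hmem le_rfl)
    rw [hre]

theorem energyProj_mul {H : Matrix ι ι ℂ} (hH : H.IsHermitian) (E : ℝ) :
    energyProj H E * H = (E : ℂ) • energyProj H E := by
  have h := congrArg Matrix.conjTranspose (mul_energyProj H E)
  rwa [Matrix.conjTranspose_mul, Matrix.conjTranspose_smul, hH.eq,
    ((isResolution_energyProj hH).isHermitian E).eq, Complex.star_def, Complex.conj_ofReal] at h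

theorem energyProj_comm {H : Matrix ι ι ℂ} (hH : H.IsHermitian) {A : Matrix ι ι ℂ}
    (hA : A * H = H * A) (E : ℝ) : energyProj H E * A = A * energyProj H E := by
  refine (isResolution_energyProj hH).intertwine (isResolution_energyProj hH) (fun E => ?_) E
  refine projMatrix_mul_of_range_le fun v => Module.End.mem_eigenspace_iff.2 ?_
  have h : H * (A * energyProj H E) = (E : ℂ) • (A * energyProj H E) := by
    rw [← mul_assoc, ← hA, mul_assoc, mul_energyProj, mul_smul_comm]
  have h2 := congrArg (fun M => Matrix.toEuclideanLin M v) h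
  simpa only [toEuclideanLin_mul, map_smul, LinearMap.comp_apply, LinearMap.smul_apply] using h2

end EnergyProjectors

/-! ### Schur–Weyl projectors -/

section SchurWeylProjectors

variable {n : ℕ} {d d' : Type*} [Fintype d] [DecidableEq d] [Fintype d'] [DecidableEq d']

theorem isResolution_schurWeylProj (n : ℕ) (d : Type*) [Fintype d] [DecidableEq d] :
    IsResolution (Finset.univ : Finset (Nat.Partition n)) (schurWeylProj d) := by
  refine isResolution_projMatrix (fun p q hpq => ?_) ?_
  · rw [schurWeylBlock, schurWeylBlock, Submodule.isOrtho_iSup_left]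
    intro T
    rw [Submodule.isOrtho_iSup_right]
    intro T'
    rw [Submodule.isOrtho_iff_inner_eq]
    rintro _ ⟨v, rfl⟩ _ ⟨w, rfl⟩
    rw [← LinearMap.adjoint_inner_right, ← Matrix.toEuclideanLin_conjTranspose_eq_adjoint,
      ← LinearMap.comp_apply, ← toEuclideanLin_mul,
      conjTranspose_youngSymmetrizer_mul_eq_zero hpq, map_zero, LinearMap.zero_apply,
      inner_zero_right]
  · rw [eq_top_iff]
    intro v _
    -- The elements of the group algebra that send `v` into the span of the blocks are a subspace.
    have key : ∀ a ∈ Submodule.span ℂ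
        (Set.range (shapeSum : Nat.Partition n → MonoidAlgebra ℂ (Equiv.Perm (Fin n)))),
        Matrix.toEuclideanLin (permAlgRep n d a) v
          ∈ ⨆ p ∈ (Finset.univ : Finset (Nat.Partition n)), schurWeylBlock d p := by
      intro a ha
      induction ha using Submodule.span_induction with
      | mem a ha =>
        obtain ⟨p, rfl⟩ := ha
        classical
        rw [shapeSum, map_sum, map_sum, LinearMap.sum_apply]
        refine Submodule.sum_mem _ fun T _ => ?_
        refine Submodule.mem_iSup_of_mem p (Submodule.mem_iSup_of_mem (Finset.mem_univ p) ?_)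
        exact Submodule.mem_iSup_of_mem T ⟨v, rfl⟩
      | zero => simp
      | add a b _ _ ha hb =>
        rw [map_add, map_add, LinearMap.add_apply]
        exact Submodule.add_mem _ ha hb
      | smul c a _ ha =>
        rw [map_smul, map_smul, LinearMap.smul_apply]
        exact Submodule.smul_mem _ c ha
    simpa using key 1 one_mem_span_shapeSum

theorem permAlgRep_intertwine {A : Matrix (Fin n → d) (Fin n → d') ℂ}
    (hA : ∀ σ, permRep n d σ * A = A * permRep n d' σ)
    (a : MonoidAlgebra ℂ (Equiv.Perm (Fin n))) :
    permAlgRep n d a * A = A * permAlgRep n d' a := by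
  induction a using MonoidAlgebra.induction_on with
  | of σ => rw [permAlgRep_of, permAlgRep_of, hA]
  | add a b ha hb => rw [map_add, map_add, Matrix.add_mul, Matrix.mul_add, ha, hb]
  | smul r a ha => rw [map_smul, map_smul, Matrix.smul_mul, Matrix.mul_smul, ha]

/-- Matrices that commute with the permutations of the copies intertwine the Schur–Weyl
projectors of two systems. -/
theorem schurWeylProj_intertwine {A : Matrix (Fin n → d) (Fin n → d') ℂ}
    (hA : ∀ σ, permRep n d σ * A = A * permRep n d' σ) (p : Nat.Partition n) :
    schurWeylProj d p * A = A * schurWeylProj d' p := by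
  refine (isResolution_schurWeylProj n d).intertwine (isResolution_schurWeylProj n d')
    (fun p => projMatrix_mul_of_range_le fun v => ?_) p
  rw [toEuclideanLin_mul, LinearMap.comp_apply]
  have hle : schurWeylBlock d' p ≤ (schurWeylBlock d p).comap (Matrix.toEuclideanLin A) := by
    refine iSup_le fun T => ?_
    rintro _ ⟨w, rfl⟩
    refine Submodule.mem_iSup_of_mem T ⟨Matrix.toEuclideanLin A w, ?_⟩
    rw [← LinearMap.comp_apply, ← LinearMap.comp_apply, ← toEuclideanLin_mul,
      ← toEuclideanLin_mul, permAlgRep_intertwine hA]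
  exact hle (toEuclideanLin_projMatrix_mem _ v)

theorem permRep_mul_schurWeylProj (σ : Equiv.Perm (Fin n)) (p : Nat.Partition n) :
    permRep n d σ * schurWeylProj d p = schurWeylProj d p * permRep n d σ := by
  symm
  refine (isResolution_schurWeylProj n d).intertwine (isResolution_schurWeylProj n d)
    (fun p => projMatrix_mul_of_range_le fun v => ?_) p
  rw [toEuclideanLin_mul, LinearMap.comp_apply]
  have hle : schurWeylBlock d p
      ≤ (schurWeylBlock d p).comap (Matrix.toEuclideanLin (permRep n d σ)) := by
    refine iSup_le fun T => ?_
    rintro _ ⟨w, rfl⟩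
    refine Submodule.mem_iSup_of_mem (σ.symm.trans T)
      ⟨Matrix.toEuclideanLin (permRep n d σ) w, ?_⟩
    rw [← LinearMap.comp_apply, ← LinearMap.comp_apply, ← toEuclideanLin_mul,
      ← toEuclideanLin_mul, ← permAlgRep_of, ← map_mul, ← map_mul, of_mul_youngSymmetrizer]
  exact hle (toEuclideanLin_projMatrix_mem _ v)

end SchurWeylProjectors

/-! ### Product operators -/

section TensorFamilies

variable {n : ℕ} {x : Type*} [Fintype x] [DecidableEq x]

theorem tensorFamily_apply (A : Fin n → Matrix x x ℂ) (a b : Fin n → x) :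
    tensorFamily A a b = ∏ k, A k (a k) (b k) := rfl

theorem tensorFamily_mul (A B : Fin n → Matrix x x ℂ) :
    tensorFamily A * tensorFamily B = tensorFamily fun k => A k * B k := by
  ext a b
  simp only [Matrix.mul_apply, tensorFamily_apply, Finset.prod_univ_sum, Fintype.piFinset_univ,
    Finset.prod_mul_distrib]

theorem conjTranspose_tensorFamily (A : Fin n → Matrix x x ℂ) :
    (tensorFamily A)ᴴ = tensorFamily fun k => (A k)ᴴ := by
  ext a b
  simp [tensorFamily_apply, Matrix.conjTranspose_apply]

theorem tensorFamily_one : tensorFamily (fun _ : Fin n => (1 : Matrix x x ℂ)) = 1 := by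
  ext a b
  simp only [tensorFamily_apply, Matrix.one_apply, Finset.prod_ite_zero, Finset.mem_univ,
    true_implies, Finset.prod_const_one, funext_iff]

theorem tensorFamily_single (a b : Fin n → x) :
    tensorFamily (fun k => Matrix.single (a k) (b k) (1 : ℂ)) = Matrix.single a b 1 := by
  ext c d
  simp only [tensorFamily_apply, Matrix.single_apply, Finset.prod_ite_zero, Finset.mem_univ,
    true_implies, Finset.prod_const_one, funext_iff, forall_and]

/-- Product operators span, so linear maps are determined by their values on them. -/
theorem linearMap_ext_tensorFamily {M : Type*} [AddCommMonoid M] [Module ℂ M]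
    {L L' : Matrix (Fin n → x) (Fin n → x) ℂ →ₗ[ℂ] M}
    (h : ∀ A, L (tensorFamily A) = L' (tensorFamily A)) : L = L' := by
  ext ρ
  rw [Matrix.matrix_eq_sum_single ρ]
  simp only [map_sum]
  refine Finset.sum_congr rfl fun a _ => Finset.sum_congr rfl fun b _ => ?_
  have hs : Matrix.single a b (ρ a b) = ρ a b • Matrix.single a b (1 : ℂ) := by simp
  rw [hs, map_smul, map_smul, ← tensorFamily_single, h]

theorem tensorFamily_update_apply (A : Fin n → Matrix x x ℂ) (i : Fin n) (B : Matrix x x ℂ)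
    (a b : Fin n → x) : tensorFamily (Function.update A i B) a b
      = B (a i) (b i) * ∏ k ∈ Finset.univ.erase i, A k (a k) (b k) := by
  rw [tensorFamily_apply, ← Finset.mul_prod_erase _ _ (Finset.mem_univ i), Function.update_self]
  congr 1
  refine Finset.prod_congr rfl fun k hk => ?_
  rw [Function.update_of_ne (Finset.ne_of_mem_erase hk)]

theorem tensorFamily_update_add (A : Fin n → Matrix x x ℂ) (i : Fin n) (B C : Matrix x x ℂ) :
    tensorFamily (Function.update A i (B + C))
      = tensorFamily (Function.update A i B) + tensorFamily (Function.update A i C) := by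
  ext a b
  simp only [Matrix.add_apply, tensorFamily_update_apply, add_mul]

theorem tensorFamily_update_sub (A : Fin n → Matrix x x ℂ) (i : Fin n) (B C : Matrix x x ℂ) :
    tensorFamily (Function.update A i (B - C))
      = tensorFamily (Function.update A i B) - tensorFamily (Function.update A i C) := by
  ext a b
  simp only [Matrix.sub_apply, tensorFamily_update_apply, sub_mul]

theorem siteOp_mul_tensorFamily (i : Fin n) (H : Matrix x x ℂ) (A : Fin n → Matrix x x ℂ) :
    siteOp n i H * tensorFamily A = tensorFamily (Function.update A i (H * A i)) := by
  rw [siteOp, tensorFamily_mul]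
  congr 1
  ext1 k
  rcases eq_or_ne k i with rfl | hk
  · simp
  · simp [hk]

theorem tensorFamily_mul_siteOp (i : Fin n) (H : Matrix x x ℂ) (A : Fin n → Matrix x x ℂ) :
    tensorFamily A * siteOp n i H = tensorFamily (Function.update A i (A i * H)) := by
  rw [siteOp, tensorFamily_mul]
  congr 1
  ext1 k
  rcases eq_or_ne k i with rfl | hk
  · simp
  · simp [hk]

theorem siteOp_add (i : Fin n) (A B : Matrix x x ℂ) :
    siteOp n i (A + B) = siteOp n i A + siteOp n i B :=
  tensorFamily_update_add _ i A B

theorem isHermitian_totalHam {H : Matrix x x ℂ} (hH : H.IsHermitian) :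
    (totalHam n H).IsHermitian := by
  rw [Matrix.IsHermitian, totalHam, Matrix.conjTranspose_sum]
  refine Finset.sum_congr rfl fun i _ => ?_
  rw [siteOp, conjTranspose_tensorFamily]
  congr 1
  ext1 k
  rcases eq_or_ne k i with rfl | hk
  · simp [hH.eq]
  · simp [hk]

theorem permRep_apply (σ : Equiv.Perm (Fin n)) (a b : Fin n → x) :
    permRep n x σ a b = if a = b ∘ ⇑σ⁻¹ then 1 else 0 := rfl

theorem permRep_mul_apply (σ : Equiv.Perm (Fin n)) {κ : Type*} (M : Matrix (Fin n → x) κ ℂ)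
    (a : Fin n → x) (b : κ) : (permRep n x σ * M) a b = M (a ∘ ⇑σ) b := by
  rw [Matrix.mul_apply, Finset.sum_eq_single (a ∘ ⇑σ)]
  · rw [permRep_apply, if_pos (by ext i; simp), one_mul]
  · intro c _ hc
    rw [permRep_apply, if_neg (by rintro rfl; exact hc (by ext i; simp)), zero_mul]
  · simp

theorem mul_permRep_apply (σ : Equiv.Perm (Fin n)) {κ : Type*} (M : Matrix κ (Fin n → x) ℂ)
    (a : κ) (b : Fin n → x) : (M * permRep n x σ) a b = M a (b ∘ ⇑σ⁻¹) := by
  rw [Matrix.mul_apply, Finset.sum_eq_single (b ∘ ⇑σ⁻¹)]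
  · rw [permRep_apply, if_pos rfl, mul_one]
  · intro c _ hc
    rw [permRep_apply, if_neg hc, mul_zero]
  · simp

theorem permRep_mul_tensorFamily (σ : Equiv.Perm (Fin n)) (A : Fin n → Matrix x x ℂ) :
    permRep n x σ * tensorFamily A = tensorFamily (A ∘ ⇑σ⁻¹) * permRep n x σ := by
  ext a b
  rw [permRep_mul_apply, mul_permRep_apply, tensorFamily_apply, tensorFamily_apply]
  refine Fintype.prod_equiv σ _ _ fun k => ?_
  simp

theorem permRep_mul_tensorPow (σ : Equiv.Perm (Fin n)) (A : Matrix x x ℂ) :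
    permRep n x σ * tensorPow n A = tensorPow n A * permRep n x σ :=
  permRep_mul_tensorFamily σ _

theorem permRep_mul_totalHam (σ : Equiv.Perm (Fin n)) (H : Matrix x x ℂ) :
    permRep n x σ * totalHam n H = totalHam n H * permRep n x σ := by
  rw [totalHam, Finset.mul_sum, Finset.sum_mul]
  refine Fintype.sum_equiv σ _ _ fun i => ?_
  rw [siteOp, siteOp, permRep_mul_tensorFamily]
  congr 2
  ext1 k
  rcases eq_or_ne k (σ i) with rfl | hk
  · simp
  · have : σ⁻¹ k ≠ i := by rintro rfl; exact hk (by simp)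
    rw [Function.comp_apply, Function.update_of_ne this, Function.update_of_ne hk]

theorem schurWeylProj_mul_energyProj {H : Matrix x x ℂ} (hH : H.IsHermitian)
    (p : Nat.Partition n) (E : ℝ) :
    schurWeylProj x p * energyProj (totalHam n H) E
      = energyProj (totalHam n H) E * schurWeylProj x p :=
  (energyProj_comm (isHermitian_totalHam hH)
    (schurWeylProj_intertwine (fun σ => permRep_mul_totalHam σ H) p) E).symm

end TensorFamilies

/-! ### The environment and its partial trace -/

section Environment

variable {n : ℕ} {x e : Type*} [Fintype x] [DecidableEq x] [Fintype e] [DecidableEq e]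

theorem tensorEnv_apply (A : Matrix (Fin n → e) (Fin n → e) ℂ)
    (B : Matrix (Fin n → x) (Fin n → x) ℂ) (a b : Fin n → e × x) :
    tensorEnv A B a b = A (Prod.fst ∘ a) (Prod.fst ∘ b) * B (Prod.snd ∘ a) (Prod.snd ∘ b) := rfl

theorem tensorEnv_zip_apply (A : Matrix (Fin n → e) (Fin n → e) ℂ)
    (B : Matrix (Fin n → x) (Fin n → x) ℂ) (c c' : Fin n → e) (a b : Fin n → x) :
    tensorEnv A B (fun k => (c k, a k)) (fun k => (c' k, b k)) = A c c' * B a b := rfl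

theorem tensorEnv_mul (A A' : Matrix (Fin n → e) (Fin n → e) ℂ)
    (B B' : Matrix (Fin n → x) (Fin n → x) ℂ) :
    tensorEnv A B * tensorEnv A' B' = tensorEnv (A * A') (B * B') := by
  simp only [tensorEnv, Matrix.reindex_apply, Matrix.submatrix_mul_equiv,
    Matrix.mul_kronecker_mul]

theorem tensorEnv_one_one :
    tensorEnv (1 : Matrix (Fin n → e) (Fin n → e) ℂ) (1 : Matrix (Fin n → x) (Fin n → x) ℂ)
      = 1 := by
  simp [tensorEnv]

theorem tensorEnv_sum {I : Type*} (s : Finset I) (A : Matrix (Fin n → e) (Fin n → e) ℂ)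
    (B : I → Matrix (Fin n → x) (Fin n → x) ℂ) :
    tensorEnv A (∑ i ∈ s, B i) = ∑ i ∈ s, tensorEnv A (B i) := by
  ext a b
  simp only [Matrix.sum_apply, tensorEnv_apply, Finset.mul_sum]

theorem tensorEnv_tensorFamily (A : Fin n → Matrix e e ℂ) (B : Fin n → Matrix x x ℂ) :
    tensorEnv (tensorFamily A) (tensorFamily B) = tensorFamily fun k => A k ⊗ₖ B k := by
  ext a b
  simp [tensorEnv_apply, tensorFamily_apply, Finset.prod_mul_distrib]

theorem totalHam_jointHam (HE : Matrix e e ℂ) (HX : Matrix x x ℂ) :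
    totalHam n (jointHam HE HX) = tensorEnv (totalHam n HE) 1 + tensorEnv 1 (totalHam n HX) := by
  have h1 : ∀ i : Fin n, siteOp n i (HE ⊗ₖ (1 : Matrix x x ℂ)) = tensorEnv (siteOp n i HE) 1 := by
    intro i
    rw [siteOp, siteOp, ← tensorFamily_one, tensorEnv_tensorFamily]
    congr 1
    ext1 k
    rcases eq_or_ne k i with rfl | hk
    · simp
    · simp [hk]
  have h2 : ∀ i : Fin n, siteOp n i ((1 : Matrix e e ℂ) ⊗ₖ HX) = tensorEnv 1 (siteOp n i HX) := by
    intro i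
    rw [siteOp, siteOp, ← tensorFamily_one, tensorEnv_tensorFamily]
    congr 1
    ext1 k
    rcases eq_or_ne k i with rfl | hk
    · simp
    · simp [hk]
  simp only [totalHam, jointHam, siteOp_add, h1, h2, Finset.sum_add_distrib]
  congr 1
  · ext a b
    simp only [Matrix.sum_apply, tensorEnv_apply, Finset.sum_mul]
  · rw [tensorEnv_sum]

theorem permRep_prod (σ : Equiv.Perm (Fin n)) :
    permRep n (e × x) σ = tensorEnv (permRep n e σ) (permRep n x σ) := by
  ext a b
  have : a = b ∘ ⇑σ⁻¹ ↔ Prod.fst ∘ a = (Prod.fst ∘ b) ∘ ⇑σ⁻¹ ∧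
      Prod.snd ∘ a = (Prod.snd ∘ b) ∘ ⇑σ⁻¹ := by
    simp only [funext_iff, Function.comp_apply, Prod.ext_iff, forall_and]
  simp only [tensorEnv_apply, permRep, MonoidHom.coe_mk, OneHom.coe_mk, Matrix.of_apply,
    mul_ite, mul_one, mul_zero, this, ite_and]
  split_ifs <;> rfl

theorem permRep_mul_tensorEnv_one {B : Matrix (Fin n → x) (Fin n → x) ℂ}
    (σ : Equiv.Perm (Fin n)) (hB : permRep n x σ * B = B * permRep n x σ) :
    permRep n (e × x) σ * tensorEnv 1 B = tensorEnv 1 B * permRep n (e × x) σ := by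
  rw [permRep_prod, tensorEnv_mul, tensorEnv_mul, hB, mul_one, one_mul]

theorem traceEnv_apply (M : Matrix (Fin n → e × x) (Fin n → e × x) ℂ) (a b : Fin n → x) :
    traceEnv M a b = ∑ c : Fin n → e, M (fun k => (c k, a k)) (fun k => (c k, b k)) := rfl

theorem traceEnv_sum {I : Type*} (s : Finset I)
    (M : I → Matrix (Fin n → e × x) (Fin n → e × x) ℂ) :
    traceEnv (∑ i ∈ s, M i) = ∑ i ∈ s, traceEnv (M i) := by
  ext a b
  simp only [traceEnv_apply, Matrix.sum_apply]
  exact Finset.sum_comm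

theorem traceEnv_add (M N : Matrix (Fin n → e × x) (Fin n → e × x) ℂ) :
    traceEnv (M + N) = traceEnv M + traceEnv N := by
  ext a b
  simp only [traceEnv_apply, Matrix.add_apply, Finset.sum_add_distrib]

theorem traceEnv_smul (c : ℂ) (M : Matrix (Fin n → e × x) (Fin n → e × x) ℂ) :
    traceEnv (c • M) = c • traceEnv M := by
  ext a b
  simp only [traceEnv_apply, Matrix.smul_apply, Finset.smul_sum]

theorem sum_prod_fun (f : (Fin n → e × x) → ℂ) :
    ∑ a, f a = ∑ c : Fin n → e, ∑ b : Fin n → x, f fun k => (c k, b k) := by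
  rw [← (zipEquiv n e x).sum_comp, Fintype.sum_prod_type]
  rfl

theorem traceEnv_tensorEnv_one_mul (B : Matrix (Fin n → x) (Fin n → x) ℂ)
    (M : Matrix (Fin n → e × x) (Fin n → e × x) ℂ) :
    traceEnv (tensorEnv 1 B * M) = B * traceEnv M := by
  ext a b
  simp only [traceEnv_apply, Matrix.mul_apply, sum_prod_fun, tensorEnv_zip_apply, Finset.mul_sum]
  rw [Finset.sum_comm (γ := Fin n → x)]
  refine Finset.sum_congr rfl fun c _ => ?_
  rw [Finset.sum_eq_single c]
  · refine Finset.sum_congr rfl fun b' _ => ?_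
    simp
  · intro c' _ hc
    refine Finset.sum_eq_zero fun b' _ => ?_
    simp [hc.symm]
  · simp

theorem traceEnv_mul_tensorEnv_one (B : Matrix (Fin n → x) (Fin n → x) ℂ)
    (M : Matrix (Fin n → e × x) (Fin n → e × x) ℂ) :
    traceEnv (M * tensorEnv 1 B) = traceEnv M * B := by
  ext a b
  simp only [traceEnv_apply, Matrix.mul_apply, sum_prod_fun, tensorEnv_zip_apply, Finset.sum_mul]
  rw [Finset.sum_comm (γ := Fin n → x)]
  refine Finset.sum_congr rfl fun c _ => ?_
  rw [Finset.sum_eq_single c]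
  · refine Finset.sum_congr rfl fun b' _ => ?_
    simp
  · intro c' _ hc
    refine Finset.sum_eq_zero fun b' _ => ?_
    simp [hc]
  · simp

/-- Operators of the environment are cyclic under the partial trace over it. -/
theorem traceEnv_tensorEnv_mul_comm (A : Matrix (Fin n → e) (Fin n → e) ℂ)
    (M : Matrix (Fin n → e × x) (Fin n → e × x) ℂ) :
    traceEnv (tensorEnv A 1 * M) = traceEnv (M * tensorEnv A 1) := by
  ext a b
  simp only [traceEnv_apply, Matrix.mul_apply, sum_prod_fun, tensorEnv_zip_apply]
  rw [Finset.sum_comm]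
  refine Finset.sum_congr rfl fun c _ => Finset.sum_congr rfl fun c' _ => ?_
  rw [Finset.sum_eq_single a, Finset.sum_eq_single b]
  · simp [mul_comm]
  · intro b' _ hb
    simp [hb]
  · simp
  · intro b' _ hb
    simp [hb.symm]
  · simp

theorem traceEnv_tensorFamily (M : Fin n → Matrix (e × x) (e × x) ℂ) :
    traceEnv (tensorFamily M) = tensorFamily fun k => traceFst (M k) := by
  ext a b
  simp only [traceEnv_apply, tensorFamily_apply, traceFst, Matrix.of_apply,
    Finset.prod_univ_sum, Fintype.piFinset_univ]

/-- The isometry that adjoins the product state `ψ ⊗ ⋯ ⊗ ψ` of the environment. -/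
def adjoinState (n : ℕ) (x : Type*) [DecidableEq x] (ψ : e → ℂ) :
    Matrix (Fin n → e × x) (Fin n → x) ℂ :=
  Matrix.of fun a b => if Prod.snd ∘ a = b then ∏ k, ψ (a k).1 else 0

theorem tensorEnv_ketBra (ψ : e → ℂ) (ρ : Matrix (Fin n → x) (Fin n → x) ℂ) :
    tensorEnv (tensorPow n (ketBra ψ)) ρ = adjoinState n x ψ * ρ * (adjoinState n x ψ)ᴴ := by
  ext a b
  simp [Matrix.mul_apply, tensorEnv_apply, adjoinState, tensorPow, tensorFamily_apply, ketBra,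
    Matrix.vecMulVec_apply, Finset.prod_mul_distrib, apply_ite]
  ring

theorem permRep_mul_adjoinState (σ : Equiv.Perm (Fin n)) (ψ : e → ℂ) :
    permRep n (e × x) σ * adjoinState n x ψ = adjoinState n x ψ * permRep n x σ := by
  ext a b
  rw [permRep_mul_apply, mul_permRep_apply]
  have h1 : Prod.snd ∘ a ∘ ⇑σ = b ↔ Prod.snd ∘ a = b ∘ ⇑σ⁻¹ := by
    constructor
    · rintro rfl; ext i; simp
    · intro h
      rw [← Function.comp_assoc, h]; ext i; simp
  have h2 : ∏ k, ψ ((a ∘ ⇑σ) k).1 = ∏ k, ψ (a k).1 := Equiv.prod_comp σ fun k => ψ (a k).1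
  simp only [adjoinState, Matrix.of_apply, h1, h2]

end Environment

/-! ### Time covariance -/

section Covariance

variable {n : ℕ} {x e : Type*} [Fintype x] [DecidableEq x] [Fintype e] [DecidableEq e]

/-- The tensor power of a channel has the tensor power of a dilation of it as a dilation. -/
theorem channelPow_eq_traceEnv {F : Matrix x x ℂ →ₗ[ℂ] Matrix x x ℂ} {ψ : e → ℂ}
    {V : Matrix (e × x) (e × x) ℂ}
    (hF : ∀ ρ : Matrix x x ℂ, F ρ = traceFst (V * (ketBra ψ ⊗ₖ ρ) * Vᴴ))
    (ρ : Matrix (Fin n → x) (Fin n → x) ℂ) :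
    channelPow n F ρ
      = traceEnv (tensorPow n V * tensorEnv (tensorPow n (ketBra ψ)) ρ * (tensorPow n V)ᴴ) := by
  let L : Matrix (Fin n → x) (Fin n → x) ℂ →ₗ[ℂ] Matrix (Fin n → x) (Fin n → x) ℂ :=
    { toFun := fun ρ =>
        traceEnv (tensorPow n V * tensorEnv (tensorPow n (ketBra ψ)) ρ * (tensorPow n V)ᴴ)
      map_add' := fun ρ σ => by
        rw [← traceEnv_add, ← add_mul, ← mul_add]
        congr 3
        ext a b
        simp only [tensorEnv_apply, Matrix.add_apply, mul_add]
      map_smul' := fun c ρ => by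
        rw [RingHom.id_apply, ← traceEnv_smul, ← smul_mul_assoc, ← mul_smul_comm]
        congr 3
        ext a b
        simp only [tensorEnv_apply, Matrix.smul_apply, smul_eq_mul]
        ring }
  have h : channelPow n F = L := linearMap_ext_tensorFamily fun A => by
    rw [channelPow_tensorFamily]
    simp only [L, LinearMap.coe_mk, AddHom.coe_mk, tensorPow, tensorEnv_tensorFamily,
      conjTranspose_tensorFamily, tensorFamily_mul, traceEnv_tensorFamily, hF]
  rw [h]
  rfl

section Generator

open scoped Matrix.Norms.Operator

/-- Time covariance in infinitesimal form: the map commutes with the commutator with `H`. -/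
theorem IsTimeCovariant.map_commutator {H : Matrix x x ℂ} {F : Matrix x x ℂ →ₗ[ℂ] Matrix x x ℂ}
    (h : IsTimeCovariant H F) (ρ : Matrix x x ℂ) :
    F (H * ρ - ρ * H) = H * F ρ - F ρ * H := by
  have hexp : ∀ σ : Matrix x x ℂ, HasDerivAt (fun t : ℝ =>
      NormedSpace.exp (-(Complex.I * t) • H) * σ * NormedSpace.exp ((Complex.I * t) • H))
      (-(Complex.I • (H * σ - σ * H))) 0 := by
    intro σ
    have h1 := hasDerivAt_exp_smul_const (𝕂 := ℝ) (Complex.I • H) (0 : ℝ)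
    have h2 := hasDerivAt_exp_smul_const (𝕂 := ℝ) (-(Complex.I • H)) (0 : ℝ)
    have h3 := (h2.mul_const σ).mul h1
    have hf : (fun t : ℝ => NormedSpace.exp (-(Complex.I * t) • H) * σ *
        NormedSpace.exp ((Complex.I * t) • H)) = (fun t : ℝ =>
        NormedSpace.exp (t • -(Complex.I • H)) * σ) * fun t : ℝ =>
        NormedSpace.exp (t • (Complex.I • H)) := by
      ext1 t
      have e1 : (Complex.I * t) • H = t • (Complex.I • H) := by
        rw [mul_comm, mul_smul, Complex.coe_smul]
      rw [neg_smul, e1, Pi.mul_apply, smul_neg]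
    rw [hf]
    refine h3.congr_deriv ?_
    simp only [zero_smul, NormedSpace.exp_zero, one_mul, mul_one, neg_mul, smul_mul_assoc,
      mul_smul_comm, smul_sub]
    abel
  have hd := (LinearMap.toContinuousLinearMap (F.restrictScalars ℝ)).hasFDerivAt.comp_hasDerivAt
    (0 : ℝ) (hexp ρ)
  have hd' := hexp (F ρ)
  have heq := hd.unique (hd'.congr_of_eventuallyEq (Filter.Eventually.of_forall fun t => h t ρ))
  have heq2 : F (-(Complex.I • (H * ρ - ρ * H))) = -(Complex.I • (H * F ρ - F ρ * H)) := heq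
  rw [map_neg, map_smul] at heq2
  exact smul_right_injective _ Complex.I_ne_zero (neg_injective heq2)

end Generator

theorem channelPow_commutator {H : Matrix x x ℂ} {F : Matrix x x ℂ →ₗ[ℂ] Matrix x x ℂ}
    (h : ∀ ρ : Matrix x x ℂ, F (H * ρ - ρ * H) = H * F ρ - F ρ * H)
    (ρ : Matrix (Fin n → x) (Fin n → x) ℂ) :
    channelPow n F (totalHam n H * ρ - ρ * totalHam n H)
      = totalHam n H * channelPow n F ρ - channelPow n F ρ * totalHam n H := by
  let D : Matrix (Fin n → x) (Fin n → x) ℂ →ₗ[ℂ] Matrix (Fin n → x) (Fin n → x) ℂ :=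
    LinearMap.mulLeft ℂ (totalHam n H) - LinearMap.mulRight ℂ (totalHam n H)
  have hD : ∀ A : Fin n → Matrix x x ℂ, D (tensorFamily A)
      = ∑ i, tensorFamily (Function.update A i (H * A i - A i * H)) := by
    intro A
    simp only [D, LinearMap.sub_apply, LinearMap.mulLeft_apply, LinearMap.mulRight_apply,
      totalHam, Finset.sum_mul, Finset.mul_sum, siteOp_mul_tensorFamily, tensorFamily_mul_siteOp,
      tensorFamily_update_sub, Finset.sum_sub_distrib]
  have hcomp : channelPow n F ∘ₗ D = D ∘ₗ channelPow n F := linearMap_ext_tensorFamily fun A => by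
    rw [LinearMap.comp_apply, LinearMap.comp_apply, hD, channelPow_tensorFamily, hD, map_sum]
    refine Finset.sum_congr rfl fun i _ => ?_
    rw [channelPow_tensorFamily, ← h]
    congr 1
    ext1 k
    rcases eq_or_ne k i with rfl | hk
    · simp
    · simp [hk]
  exact LinearMap.congr_fun hcomp ρ

end Covariance

/-! ### Sums over labels -/

section LabelSums

variable {n : ℕ} {ι κ : Type*} [Fintype ι] [DecidableEq ι] [Fintype κ] [DecidableEq κ]

/-- A dephasing as a sum over the pairs of labels with the same value. -/
theorem sum_image_dephasing {I : Type*} (s : Finset I) (f : I → ℝ) (Q : I → Matrix ι ι ℂ)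
    (C : Matrix ι ι ℂ) :
    ∑ w ∈ s.image f, (∑ l ∈ s with f l = w, Q l) * C * (∑ l ∈ s with f l = w, Q l)
      = ∑ l ∈ s, ∑ l' ∈ s, if f l = f l' then Q l * C * Q l' else 0 := by
  rw [← Finset.sum_fiberwise_of_maps_to (fun l hl => Finset.mem_image_of_mem f hl)]
  refine Finset.sum_congr rfl fun w _ => ?_
  rw [Finset.sum_mul, Finset.sum_mul]
  refine Finset.sum_congr rfl fun l hl => ?_
  rw [Finset.mul_sum, Finset.sum_filter, (Finset.mem_filter.1 hl).2]
  simp only [eq_comm]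

theorem sum_labels {M : Type*} [AddCommMonoid M] (H : Matrix ι ι ℂ) (H' : Matrix κ κ ℂ)
    (g : ℝ × ℝ × Nat.Partition n × Nat.Partition n → M) :
    ∑ l ∈ labels n H H', g l
      = ∑ q : Nat.Partition n × Nat.Partition n, ∑ E ∈ energies H, ∑ E' ∈ energies H',
          g (E, E', q) := by
  rw [labels, Finset.univ_product_univ, Finset.sum_comm]
  simp only [Finset.sum_product]
  exact Finset.sum_congr rfl fun E _ => Finset.sum_comm

/-- The difference of the entropies of two Young diagrams. -/
def entropyDiff (q : Nat.Partition n × Nat.Partition n) : ℝ :=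
  shapeEntropy q.1 - shapeEntropy q.2

theorem freeEnergyDiff_eq (β : ℝ) (l : ℝ × ℝ × Nat.Partition n × Nat.Partition n) :
    freeEnergyDiff β l = (l.1 - l.2.1) - β⁻¹ * entropyDiff l.2.2 := by
  rw [freeEnergyDiff, entropyDiff]
  ring

/-- If the terms of a dephasing vanish unless they conserve energy, the condition on the free
energies is a condition on the entropies alone, and the sums over the energies are unrestricted. -/
theorem sum_labels_of_energy_conserving {M : Type*} [AddCommMonoid M] {β : ℝ} (hβ : 0 < β)
    (H : Matrix ι ι ℂ) (H' : Matrix κ κ ℂ)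
    (g : ℝ × ℝ × Nat.Partition n × Nat.Partition n →
      ℝ × ℝ × Nat.Partition n × Nat.Partition n → M)
    (hg : ∀ l l', l.1 - l.2.1 ≠ l'.1 - l'.2.1 → g l l' = 0) :
    ∑ l ∈ labels n H H', ∑ l' ∈ labels n H H',
        (if freeEnergyDiff β l = freeEnergyDiff β l' then g l l' else 0)
      = ∑ q : Nat.Partition n × Nat.Partition n, ∑ q' : Nat.Partition n × Nat.Partition n,
          if entropyDiff q = entropyDiff q' then
            ∑ E ∈ energies H, ∑ E' ∈ energies H', ∑ E₁ ∈ energies H, ∑ E₁' ∈ energies H',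
              g (E, E', q) (E₁, E₁', q') else 0 := by
  have hif : ∀ l l', (if freeEnergyDiff β l = freeEnergyDiff β l' then g l l' else 0)
      = if entropyDiff l.2.2 = entropyDiff l'.2.2 then g l l' else 0 := by
    intro l l'
    by_cases h : l.1 - l.2.1 = l'.1 - l'.2.1
    · refine if_congr ?_ rfl rfl
      rw [freeEnergyDiff_eq, freeEnergyDiff_eq, h, sub_right_inj,
        mul_right_inj' (inv_ne_zero hβ.ne')]
    · rw [hg l l' h, ite_self, ite_self]
  simp only [hif, sum_labels]
  refine Finset.sum_congr rfl fun q _ => ?_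
  rw [Finset.sum_congr rfl fun E _ => Finset.sum_comm, Finset.sum_comm]
  refine Finset.sum_congr rfl fun q' _ => ?_
  split_ifs
  · rfl
  · simp

end LabelSums

/-! ### The dephased map of a covariant map -/

section DephasedMap

variable {n : ℕ} {x : Type*} [Fintype x] [DecidableEq x]

/-- Products on the output factor and transposed products on the reference factor of a Choi matrix
are products after and before the map. -/
theorem choi_sandwich {y : Type*} [Fintype y] [DecidableEq y]
    (G : Matrix y y ℂ →ₗ[ℂ] Matrix y y ℂ) (A B B' A' : Matrix y y ℂ) :
    (A ⊗ₖ Bᵀ) * choi G * (A' ⊗ₖ B'ᵀ)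
      = choi (LinearMap.mulRight ℂ A' ∘ₗ LinearMap.mulLeft ℂ A ∘ₗ G ∘ₗ
          LinearMap.mulRight ℂ B' ∘ₗ LinearMap.mulLeft ℂ B) := by
  ext ⟨i, a⟩ ⟨j, b⟩
  have hs : B * Matrix.single a b (1 : ℂ) * B'
      = ∑ c, ∑ d, (B c a * B' b d) • Matrix.single c d (1 : ℂ) := by
    rw [Matrix.matrix_eq_sum_single (B * Matrix.single a b (1 : ℂ) * B')]
    refine Finset.sum_congr rfl fun c _ => Finset.sum_congr rfl fun d _ => ?_
    rw [Matrix.smul_single]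
    congr 1
    simp [Matrix.mul_apply, Matrix.single_apply, ite_and]
  simp only [choi, Matrix.of_apply, LinearMap.comp_apply, LinearMap.mulLeft_apply,
    LinearMap.mulRight_apply]
  rw [hs]
  simp only [map_sum, map_smul, Matrix.mul_apply, Fintype.sum_prod_type, Matrix.kroneckerMap_apply,
    Matrix.transpose_apply, Matrix.of_apply, Matrix.sum_apply, Matrix.smul_apply, smul_eq_mul,
    Finset.sum_mul, Finset.mul_sum]
  refine Finset.sum_congr rfl fun l _ => ?_
  rw [Finset.sum_congr rfl fun d _ => Finset.sum_comm, Finset.sum_comm]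
  refine Finset.sum_congr rfl fun c _ => Finset.sum_congr rfl fun d _ =>
    Finset.sum_congr rfl fun k _ => ?_
  ring

theorem ofChoi_sandwich {y : Type*} [Fintype y] [DecidableEq y]
    (G : Matrix y y ℂ →ₗ[ℂ] Matrix y y ℂ) (A B B' A' ρ : Matrix y y ℂ) :
    ofChoi ((A ⊗ₖ Bᵀ) * choi G * (A' ⊗ₖ B'ᵀ)) ρ = A * G (B * ρ * B') * A' := by
  rw [choi_sandwich, ofChoi_choi]
  rfl

theorem ofChoi_sum_apply {y I : Type*} [Fintype y] [DecidableEq y] (s : Finset I)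
    (C : I → Matrix (y × y) (y × y) ℂ) (ρ : Matrix y y ℂ) :
    ofChoi (∑ i ∈ s, C i) ρ = ∑ i ∈ s, ofChoi (C i) ρ := by
  ext i j
  simp only [ofChoi, LinearMap.coe_mk, AddHom.coe_mk, Matrix.of_apply, Matrix.sum_apply,
    Finset.mul_sum]
  exact (Finset.sum_congr rfl fun a _ => Finset.sum_comm).trans Finset.sum_comm

/-- The joint projector onto an energy eigenspace and a Schur–Weyl block. -/
def levelProj (H : Matrix x x ℂ) (i : ℝ × Nat.Partition n) :
    Matrix (Fin n → x) (Fin n → x) ℂ :=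
  energyProj (totalHam n H) i.1 * schurWeylProj x i.2

theorem workCostDephased_apply (β : ℝ) (H : Matrix x x ℂ)
    (G : Matrix (Fin n → x) (Fin n → x) ℂ →ₗ[ℂ] Matrix (Fin n → x) (Fin n → x) ℂ)
    (ρ : Matrix (Fin n → x) (Fin n → x) ℂ) :
    workCostDephased β n H G ρ
      = ∑ l ∈ labels n (totalHam n H) (totalHam n H), ∑ l' ∈ labels n (totalHam n H) (totalHam n H),
          if freeEnergyDiff β l = freeEnergyDiff β l' then
            levelProj H (l.1, l.2.2.1) *
              G (levelProj H (l.2.1, l.2.2.2) * ρ * levelProj H (l'.2.1, l'.2.2.2)) *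
              levelProj H (l'.1, l'.2.2.1)
          else 0 := by
  simp only [workCostDephased, choiProj]
  rw [sum_image_dephasing, ofChoi_sum_apply]
  refine Finset.sum_congr rfl fun l _ => ?_
  rw [ofChoi_sum_apply]
  refine Finset.sum_congr rfl fun l' _ => ?_
  split_ifs
  · rw [ofChoi_sandwich]
    rfl
  · ext i j
    simp [ofChoi]

theorem isResolution_levelProj {H : Matrix x x ℂ} (hH : H.IsHermitian) (n : ℕ) :
    IsResolution (energies (totalHam n H) ×ˢ (Finset.univ : Finset (Nat.Partition n)))
      (levelProj H) := by
  have hE := isResolution_energyProj (isHermitian_totalHam (n := n) hH)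
  have hS := isResolution_schurWeylProj n x
  have hc := fun (p : Nat.Partition n) (E : ℝ) => schurWeylProj_mul_energyProj hH p E
  have hmul : ∀ i j : ℝ × Nat.Partition n, levelProj H i * levelProj H j
      = (energyProj (totalHam n H) i.1 * energyProj (totalHam n H) j.1)
        * (schurWeylProj x i.2 * schurWeylProj x j.2) := by
    intro i j
    rw [levelProj, levelProj, mul_assoc, ← mul_assoc (schurWeylProj x i.2), hc]
    simp only [mul_assoc]
  refine ⟨fun i => ?_, fun i => ?_, fun i j hij => ?_, ?_⟩
  · rw [Matrix.IsHermitian, levelProj, Matrix.conjTranspose_mul, (hE.isHermitian _).eq,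
      (hS.isHermitian _).eq, hc]
  · rw [hmul, hE.mul_self, hS.mul_self, levelProj]
  · rw [hmul]
    by_cases h : i.1 = j.1
    · rw [hS.mul_of_ne _ _ fun h' => hij (Prod.ext h h'), mul_zero]
    · rw [hE.mul_of_ne _ _ h, zero_mul]
  · simp only [levelProj, Finset.sum_product, ← Finset.mul_sum, hS.sum_eq_one,
      hE.sum_eq_one, mul_one]

theorem totalHam_mul_levelProj (H : Matrix x x ℂ) (i : ℝ × Nat.Partition n) :
    totalHam n H * levelProj H i = (i.1 : ℂ) • levelProj H i := by
  rw [levelProj, ← mul_assoc, mul_energyProj, smul_mul_assoc]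

theorem levelProj_mul_totalHam {H : Matrix x x ℂ} (hH : H.IsHermitian)
    (i : ℝ × Nat.Partition n) :
    levelProj H i * totalHam n H = (i.1 : ℂ) • levelProj H i := by
  rw [levelProj, ← schurWeylProj_mul_energyProj hH, mul_assoc,
    energyProj_mul (isHermitian_totalHam hH), mul_smul_comm]

/-- A map that commutes with the commutator with `H` conserves energy differences. -/
theorem sandwich_eq_zero_of_commutator {y : Type*} [Fintype y] [DecidableEq y]
    {H : Matrix y y ℂ} {G : Matrix y y ℂ →ₗ[ℂ] Matrix y y ℂ}
    (hG : ∀ ρ, G (H * ρ - ρ * H) = H * G ρ - G ρ * H) {A B B' A' : Matrix y y ℂ}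
    {a b b' a' : ℂ} (hA : A * H = a • A) (hB : H * B = b • B) (hB' : B' * H = b' • B')
    (hA' : H * A' = a' • A') (hne : a - b ≠ a' - b') (ρ : Matrix y y ℂ) :
    A * G (B * ρ * B') * A' = 0 := by
  have h := congrArg (fun M => A * M * A') (hG (B * ρ * B'))
  have h1 : H * (B * ρ * B') - B * ρ * B' * H = (b - b') • (B * ρ * B') := by
    rw [mul_assoc (B * ρ), hB', ← mul_assoc, ← mul_assoc, hB, sub_smul]
    simp only [smul_mul_assoc, mul_smul_comm]
  have h2 : A * (H * G (B * ρ * B') - G (B * ρ * B') * H) * A'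
      = (a - a') • (A * G (B * ρ * B') * A') := by
    rw [mul_sub, sub_mul, ← mul_assoc, hA, ← mul_assoc, mul_assoc (A * G (B * ρ * B')), hA',
      sub_smul]
    simp only [smul_mul_assoc, mul_smul_comm]
  simp only [h1, h2, map_smul, mul_smul_comm, smul_mul_assoc] at h
  rw [← sub_eq_zero, ← sub_smul] at h
  refine (smul_eq_zero.1 h).resolve_left fun h0 => hne ?_
  linear_combination -h0

/-- For a covariant map the energies drop out of the dephasing. -/
theorem workCostDephased_eq_of_commutator {β : ℝ} (hβ : 0 < β) {H : Matrix x x ℂ}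
    (hH : H.IsHermitian)
    {G : Matrix (Fin n → x) (Fin n → x) ℂ →ₗ[ℂ] Matrix (Fin n → x) (Fin n → x) ℂ}
    (hG : ∀ ρ, G (totalHam n H * ρ - ρ * totalHam n H)
      = totalHam n H * G ρ - G ρ * totalHam n H)
    (ρ : Matrix (Fin n → x) (Fin n → x) ℂ) :
    workCostDephased β n H G ρ
      = ∑ q : Nat.Partition n × Nat.Partition n, ∑ q' : Nat.Partition n × Nat.Partition n,
          if entropyDiff q = entropyDiff q' then
            schurWeylProj x q.1 * G (schurWeylProj x q.2 * ρ * schurWeylProj x q'.2) *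
              schurWeylProj x q'.1
          else 0 := by
  rw [workCostDephased_apply, sum_labels_of_energy_conserving hβ]
  · refine Finset.sum_congr rfl fun q _ => Finset.sum_congr rfl fun q' _ => ?_
    have hE := (isResolution_energyProj (isHermitian_totalHam (n := n) hH)).sum_eq_one
    simp only [levelProj, ← Finset.sum_mul, ← Finset.mul_sum, ← map_sum, hE, one_mul]
  · intro l l' hl
    refine sandwich_eq_zero_of_commutator hG (levelProj_mul_totalHam hH _)
      (totalHam_mul_levelProj H _) (levelProj_mul_totalHam hH _) (totalHam_mul_levelProj H _) ?_ ρ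
    exact_mod_cast hl

end DephasedMap

/-! ### The dephased dilation -/

section DephasedDilation

variable {n : ℕ} {x e : Type*} [Fintype x] [DecidableEq x] [Fintype e] [DecidableEq e]

theorem tensorEnv_smul (A : Matrix (Fin n → e) (Fin n → e) ℂ) (c : ℂ)
    (B : Matrix (Fin n → x) (Fin n → x) ℂ) : tensorEnv A (c • B) = c • tensorEnv A B := by
  ext a b
  simp only [tensorEnv_apply, Matrix.smul_apply, smul_eq_mul]
  ring

theorem isHermitian_jointHam {HE : Matrix e e ℂ} {HX : Matrix x x ℂ} (hE : HE.IsHermitian)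
    (hX : HX.IsHermitian) : (jointHam HE HX).IsHermitian := by
  rw [Matrix.IsHermitian, jointHam, Matrix.conjTranspose_add, Matrix.conjTranspose_kronecker,
    Matrix.conjTranspose_kronecker, hE.eq, hX.eq, Matrix.conjTranspose_one,
    Matrix.conjTranspose_one]

/-- The summand of `envProj` for one label. -/
def envLevelProj (HE : Matrix e e ℂ) (HX : Matrix x x ℂ)
    (l : ℝ × ℝ × Nat.Partition n × Nat.Partition n) :
    Matrix (Fin n → e × x) (Fin n → e × x) ℂ :=
  tensorEnv 1 (energyProj (totalHam n HX) l.2.1) * tensorEnv 1 (schurWeylProj x l.2.2.2) *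
    schurWeylProj (e × x) l.2.2.1 * energyProj (totalHam n (jointHam HE HX)) l.1

theorem commute_tensorEnv_one_totalHam {HE : Matrix e e ℂ} {HX : Matrix x x ℂ}
    {B : Matrix (Fin n → x) (Fin n → x) ℂ} (hB : Commute B (totalHam n HX)) :
    Commute (tensorEnv 1 B) (totalHam n (jointHam HE HX)) := by
  rw [totalHam_jointHam]
  refine Commute.add_right ?_ ?_
  · rw [Commute, SemiconjBy, tensorEnv_mul, tensorEnv_mul]
    simp only [one_mul, mul_one]
  · rw [Commute, SemiconjBy, tensorEnv_mul, tensorEnv_mul, hB.eq]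

theorem commute_schurWeylProj_totalHam (H : Matrix x x ℂ) (p : Nat.Partition n) :
    Commute (schurWeylProj x p) (totalHam n H) :=
  schurWeylProj_intertwine (fun σ => permRep_mul_totalHam σ H) p

theorem commute_tensorEnv_one_schurWeylProj {B : Matrix (Fin n → x) (Fin n → x) ℂ}
    (hB : ∀ σ, permRep n x σ * B = B * permRep n x σ) (p : Nat.Partition n) :
    Commute (schurWeylProj (e × x) p) (tensorEnv 1 B) :=
  schurWeylProj_intertwine (fun σ => permRep_mul_tensorEnv_one σ (hB σ)) p

/-- The Hamiltonian of the environment is the difference of the two Hamiltonians whose energies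
label the projectors of the dephasing. -/
theorem totalHam_env (HE : Matrix e e ℂ) (HX : Matrix x x ℂ) :
    tensorEnv (totalHam n HE) 1
      = totalHam n (jointHam HE HX) - tensorEnv 1 (totalHam n HX) := by
  rw [totalHam_jointHam, add_sub_cancel_right]

theorem totalHam_env_mul_envLevelProj {HE : Matrix e e ℂ} {HX : Matrix x x ℂ}
    (hX : HX.IsHermitian) (l : ℝ × ℝ × Nat.Partition n × Nat.Partition n) :
    tensorEnv (totalHam n HE) 1 * envLevelProj HE HX l
      = ((l.1 : ℂ) - l.2.1) • envLevelProj HE HX l := by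
  have hc : Commute (tensorEnv 1 (energyProj (totalHam n HX) l.2.1) *
      tensorEnv 1 (schurWeylProj x l.2.2.2) * schurWeylProj (e × x) l.2.2.1)
      (totalHam n (jointHam HE HX)) :=
    ((commute_tensorEnv_one_totalHam (energyProj_comm (isHermitian_totalHam hX) rfl _)).mul_left
      (commute_tensorEnv_one_totalHam (commute_schurWeylProj_totalHam HX _))).mul_left
      (commute_schurWeylProj_totalHam _ _)
  rw [totalHam_env HE HX, sub_mul, sub_smul]
  congr 1
  · rw [envLevelProj, ← mul_assoc, ← hc.eq, mul_assoc, mul_energyProj, mul_smul_comm]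
  · simp only [envLevelProj, ← mul_assoc]
    rw [tensorEnv_mul, mul_energyProj, one_mul]
    rw [tensorEnv_smul]
    simp only [smul_mul_assoc]

theorem commute_energyProj_tensorEnv_one_totalHam {HE : Matrix e e ℂ} {HX : Matrix x x ℂ}
    (hE : HE.IsHermitian) (hX : HX.IsHermitian) (E : ℝ) :
    Commute (energyProj (totalHam n (jointHam HE HX)) E) (tensorEnv 1 (totalHam n HX)) := by
  have h : Commute (tensorEnv 1 (totalHam n HX)) (totalHam n (jointHam HE HX)) :=
    commute_tensorEnv_one_totalHam (Commute.refl _)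
  exact energyProj_comm (A := tensorEnv 1 (totalHam n HX))
    (isHermitian_totalHam (isHermitian_jointHam hE hX)) h.eq E

theorem envLevelProj_mul_totalHam_env {HE : Matrix e e ℂ} {HX : Matrix x x ℂ}
    (hE : HE.IsHermitian) (hX : HX.IsHermitian)
    (l : ℝ × ℝ × Nat.Partition n × Nat.Partition n) :
    envLevelProj HE HX l * tensorEnv (totalHam n HE) 1
      = ((l.1 : ℂ) - l.2.1) • envLevelProj HE HX l := by
  have h1 : Commute (tensorEnv (1 : Matrix (Fin n → e) (Fin n → e) ℂ)
      (schurWeylProj x l.2.2.2)) (tensorEnv 1 (totalHam n HX)) := by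
    rw [Commute, SemiconjBy, tensorEnv_mul, tensorEnv_mul,
      (commute_schurWeylProj_totalHam HX _).eq]
  have h2 : Commute (schurWeylProj (e × x) l.2.2.1) (tensorEnv 1 (totalHam n HX)) :=
    commute_tensorEnv_one_schurWeylProj (fun σ => permRep_mul_totalHam σ HX) _
  have h3 := commute_energyProj_tensorEnv_one_totalHam (n := n) hE hX l.1
  have hR : envLevelProj HE HX l * totalHam n (jointHam HE HX)
      = (l.1 : ℂ) • envLevelProj HE HX l := by
    rw [envLevelProj, mul_assoc,
      energyProj_mul (isHermitian_totalHam (isHermitian_jointHam hE hX)), mul_smul_comm]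
  have hS : envLevelProj HE HX l * tensorEnv 1 (totalHam n HX)
      = (l.2.1 : ℂ) • envLevelProj HE HX l := by
    have hES : tensorEnv (1 : Matrix (Fin n → e) (Fin n → e) ℂ)
        (energyProj (totalHam n HX) l.2.1) * tensorEnv 1 (totalHam n HX)
          = (l.2.1 : ℂ) • tensorEnv 1 (energyProj (totalHam n HX) l.2.1) := by
      rw [tensorEnv_mul, energyProj_mul (isHermitian_totalHam hX), one_mul, tensorEnv_smul]
    rw [envLevelProj, mul_assoc, h3.eq, ← mul_assoc, mul_assoc _ _ (tensorEnv 1 (totalHam n HX)),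
      h2.eq, ← mul_assoc, mul_assoc _ _ (tensorEnv 1 (totalHam n HX)), h1.eq, ← mul_assoc, hES]
    simp only [smul_mul_assoc]
  rw [totalHam_env HE HX, mul_sub, sub_smul, hR, hS]

/-- The partial trace removes the terms that change the energy of the environment. -/
theorem traceEnv_envLevelProj_eq_zero {HE : Matrix e e ℂ} {HX : Matrix x x ℂ}
    (hE : HE.IsHermitian) (hX : HX.IsHermitian)
    {l l' : ℝ × ℝ × Nat.Partition n × Nat.Partition n} (hne : l.1 - l.2.1 ≠ l'.1 - l'.2.1)
    (M : Matrix (Fin n → e × x) (Fin n → e × x) ℂ) :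
    traceEnv (envLevelProj HE HX l * M * envLevelProj HE HX l') = 0 := by
  have h := traceEnv_tensorEnv_mul_comm (totalHam n HE)
    (envLevelProj HE HX l * M * envLevelProj HE HX l')
  rw [← mul_assoc, ← mul_assoc, totalHam_env_mul_envLevelProj hX, mul_assoc _ _
    (tensorEnv (totalHam n HE) 1), envLevelProj_mul_totalHam_env hE hX, smul_mul_assoc,
    smul_mul_assoc, mul_smul_comm, traceEnv_smul, traceEnv_smul, ← sub_eq_zero, ← sub_smul] at h
  refine (smul_eq_zero.1 h).resolve_left fun h0 => hne ?_
  exact_mod_cast sub_eq_zero.1 h0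

/-- After the partial trace, the energies drop out of the dephasing of the dilation. -/
theorem traceEnv_envDephasing {β : ℝ} (hβ : 0 < β) {HE : Matrix e e ℂ} {HX : Matrix x x ℂ}
    (hE : HE.IsHermitian) (hX : HX.IsHermitian)
    (M : Matrix (Fin n → e × x) (Fin n → e × x) ℂ) :
    traceEnv (envDephasing β n HE HX M)
      = ∑ q : Nat.Partition n × Nat.Partition n, ∑ q' : Nat.Partition n × Nat.Partition n,
          if entropyDiff q = entropyDiff q' then
            schurWeylProj x q.2 *
              traceEnv (schurWeylProj (e × x) q.1 * M * schurWeylProj (e × x) q'.1) *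
              schurWeylProj x q'.2
          else 0 := by
  have h0 : envDephasing β n HE HX M
      = ∑ l ∈ labels n (totalHam n (jointHam HE HX)) (totalHam n HX),
          ∑ l' ∈ labels n (totalHam n (jointHam HE HX)) (totalHam n HX),
            if freeEnergyDiff β l = freeEnergyDiff β l' then
              envLevelProj HE HX l * M * envLevelProj HE HX l' else 0 :=
    sum_image_dephasing _ _ (envLevelProj HE HX) M
  have hz : traceEnv (0 : Matrix (Fin n → e × x) (Fin n → e × x) ℂ) = 0 := by
    ext a b
    simp [traceEnv_apply]
  simp only [h0, traceEnv_sum, apply_ite traceEnv, hz]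
  rw [sum_labels_of_energy_conserving hβ _ _ _
    fun l l' hne => traceEnv_envLevelProj_eq_zero hE hX hne M]
  refine Finset.sum_congr rfl fun q _ => Finset.sum_congr rfl fun q' _ => ?_
  have hJ := (isResolution_energyProj
    (isHermitian_totalHam (n := n) (isHermitian_jointHam hE hX))).sum_eq_one
  have hS := (isResolution_energyProj (isHermitian_totalHam (n := n) hX)).sum_eq_one
  simp only [envLevelProj, ← traceEnv_sum, ← Finset.sum_mul, ← Finset.mul_sum, hJ, mul_one,
    ← tensorEnv_sum, hS, tensorEnv_one_one, one_mul]
  rw [← (commute_tensorEnv_one_schurWeylProj (e := e)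
      (fun σ => permRep_mul_schurWeylProj σ q'.2) q'.1).eq, ← mul_assoc,
    traceEnv_mul_tensorEnv_one, mul_assoc, mul_assoc, traceEnv_tensorEnv_one_mul, ← mul_assoc]

theorem workCostDephased_channelPow_eq {HX : Matrix x x ℂ} (hX : HX.IsHermitian) {β : ℝ}
    (hβ : 0 < β) {F : Matrix x x ℂ →ₗ[ℂ] Matrix x x ℂ} (hcov : IsTimeCovariant HX F)
    {HE : Matrix e e ℂ} {ψ : e → ℂ} {V : Matrix (e × x) (e × x) ℂ}
    (hd : IsEnergyConservingDilation HX F HE ψ V) (ρ : Matrix (Fin n → x) (Fin n → x) ℂ) :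
    workCostDephased β n HX (channelPow n F) ρ
      = traceEnv (envDephasing β n HE HX
          (tensorPow n V * tensorEnv (tensorPow n (ketBra ψ)) ρ * (tensorPow n V)ᴴ)) := by
  rw [workCostDephased_eq_of_commutator hβ hX (channelPow_commutator hcov.map_commutator),
    traceEnv_envDephasing hβ hd.isHermitian hX, ← (Equiv.prodComm _ _).sum_comp]
  refine Finset.sum_congr rfl fun q _ => ?_
  rw [← (Equiv.prodComm _ _).sum_comp]
  refine Finset.sum_congr rfl fun q' _ => if_congr ?_ ?_ rfl
  · simp only [entropyDiff, Equiv.prodComm_apply, Prod.fst_swap, Prod.snd_swap]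
    constructor <;> intro h <;> linarith
  · -- The Schur–Weyl projectors of `(EX)ⁿ` pass through the dilating isometry to the input.
    have hV : ∀ p : Nat.Partition n, schurWeylProj (e × x) p *
        (tensorPow n V * adjoinState n x ψ)
          = tensorPow n V * adjoinState n x ψ * schurWeylProj x p := fun p =>
      schurWeylProj_intertwine (fun σ => by
        rw [← Matrix.mul_assoc, permRep_mul_tensorPow, Matrix.mul_assoc,
          permRep_mul_adjoinState, Matrix.mul_assoc]) p
    have hV' : ∀ p : Nat.Partition n,
        (tensorPow n V * adjoinState n x ψ)ᴴ * schurWeylProj (e × x) p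
          = schurWeylProj x p * (tensorPow n V * adjoinState n x ψ)ᴴ := fun p => by
      have h := congrArg Matrix.conjTranspose (hV p)
      rwa [Matrix.conjTranspose_mul, Matrix.conjTranspose_mul _ (schurWeylProj x p),
        ((isResolution_schurWeylProj n (e × x)).isHermitian p).eq,
        ((isResolution_schurWeylProj n x).isHermitian p).eq] at h
    have hM : ∀ ρ : Matrix (Fin n → x) (Fin n → x) ℂ,
        tensorPow n V * tensorEnv (tensorPow n (ketBra ψ)) ρ * (tensorPow n V)ᴴ
          = tensorPow n V * adjoinState n x ψ * ρ * (tensorPow n V * adjoinState n x ψ)ᴴ := by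
      intro ρ
      rw [tensorEnv_ketBra, Matrix.conjTranspose_mul]
      simp only [Matrix.mul_assoc]
    have key : ∀ p p' : Nat.Partition n, schurWeylProj (e × x) p *
        (tensorPow n V * tensorEnv (tensorPow n (ketBra ψ)) ρ * (tensorPow n V)ᴴ) *
          schurWeylProj (e × x) p'
        = tensorPow n V * tensorEnv (tensorPow n (ketBra ψ))
            (schurWeylProj x p * ρ * schurWeylProj x p') * (tensorPow n V)ᴴ := by
      intro p p'
      rw [hM, hM, Matrix.mul_assoc _ _ (schurWeylProj (e × x) p'),
        Matrix.mul_assoc _ _ (schurWeylProj (e × x) p'), hV', ← Matrix.mul_assoc,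
        ← Matrix.mul_assoc, ← Matrix.mul_assoc, hV]
      simp only [Matrix.mul_assoc]
    rw [key, ← channelPow_eq_traceEnv hd.dilation]
    rfl

end DephasedDilation

/-! ### Complete positivity and trace preservation -/

section DephasedChannel

variable {y : Type*} [Fintype y] [DecidableEq y]

/-- The Choi matrix is the image of a rank-one operator under an ampliation. -/
theorem IsChannel.posSemidef_choi {G : Matrix y y ℂ →ₗ[ℂ] Matrix y y ℂ} (hG : IsChannel G) :
    (choi G).PosSemidef := by
  let ε : y ≃ Fin (Fintype.card y) := Fintype.equivFin y
  -- The vector `∑ j, |j⟩ ⊗ |ε j⟩`.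
  let v : y × Fin (Fintype.card y) → ℂ := fun p => if p.1 = ε.symm p.2 then 1 else 0
  have h := hG.completelyPositive _ _ (Matrix.posSemidef_vecMulVec_self_star v)
  have h2 : choi G = (ampliation G _ (Matrix.vecMulVec v (star v))).submatrix
      (Prod.map id ε) (Prod.map id ε) := by
    ext p q
    have h3 : (Matrix.of fun a b => Matrix.vecMulVec v (star v) (a, ε p.2) (b, ε q.2))
        = Matrix.single p.2 q.2 (1 : ℂ) := by
      ext a b
      simp only [v, Matrix.single_apply, Matrix.of_apply, Matrix.vecMulVec_apply, Pi.star_apply,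
        Equiv.symm_apply_apply, ite_and, @eq_comm _ a, @eq_comm _ b]
      split_ifs <;> simp
    simp only [choi, ampliation, Matrix.of_apply, Matrix.submatrix_apply, Prod.map_fst,
      Prod.map_snd, id]
    rw [h3]
  rw [h2]
  exact h.submatrix _

theorem posSemidef_ampliation_of_choi {G : Matrix y y ℂ →ₗ[ℂ] Matrix y y ℂ}
    (hG : (choi G).PosSemidef) (k : ℕ) (M : Matrix (y × Fin k) (y × Fin k) ℂ)
    (hM : M.PosSemidef) : (ampliation G k M).PosSemidef := by
  obtain ⟨m, v, hv⟩ := Matrix.posSemidef_iff_eq_sum_vecMulVec.1 hG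
  -- The vectors of a decomposition of the Choi matrix are Kraus operators.
  let K : Fin m → Matrix (y × Fin k) (y × Fin k) ℂ := fun r =>
    Matrix.of fun p q => if p.2 = q.2 then v r (p.1, q.1) else 0
  have h : ampliation G k M = ∑ r, K r * M * (K r)ᴴ := by
    ext ⟨i, p⟩ ⟨j, q⟩
    rw [← ofChoi_choi G, hv]
    simp only [ampliation, ofChoi, LinearMap.coe_mk, AddHom.coe_mk, Matrix.of_apply,
      Matrix.sum_apply, Matrix.mul_apply, K, Matrix.conjTranspose_apply, Fintype.sum_prod_type,
      apply_ite star, star_zero, ite_mul, mul_ite, zero_mul, mul_zero, Matrix.vecMulVec_apply,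
      Pi.star_apply, Finset.sum_ite_eq, Finset.mem_univ, if_true, Finset.mul_sum, Finset.sum_mul]
    rw [Finset.sum_comm, Finset.sum_congr rfl fun b _ => Finset.sum_comm, Finset.sum_comm]
    refine Finset.sum_congr rfl fun r _ => Finset.sum_congr rfl fun b _ =>
      Finset.sum_congr rfl fun a _ => ?_
    ring
  rw [h]
  exact Matrix.posSemidef_sum _ fun r _ => hM.mul_mul_conjTranspose_same _

variable {n : ℕ} {x : Type*} [Fintype x] [DecidableEq x]

theorem isHermitian_choiProj {HX : Matrix x x ℂ} (hX : HX.IsHermitian) (β w : ℝ) :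
    (choiProj β n HX w).IsHermitian := by
  have hP := fun i => ((isResolution_levelProj hX n).isHermitian i)
  rw [Matrix.IsHermitian, choiProj, Matrix.conjTranspose_sum]
  refine Finset.sum_congr rfl fun l _ => ?_
  rw [Matrix.conjTranspose_kronecker]
  congr 1
  · exact hP (l.1, l.2.2.1)
  · exact (hP (l.2.1, l.2.2.2)).transpose

theorem sum_labels_eq_sum_levels {M : Type*} [AddCommMonoid M] (H : Matrix x x ℂ)
    (g : ℝ × ℝ × Nat.Partition n × Nat.Partition n → M) :
    ∑ l ∈ labels n H H, g l
      = ∑ i ∈ energies H ×ˢ (Finset.univ : Finset (Nat.Partition n)),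
          ∑ j ∈ energies H ×ˢ (Finset.univ : Finset (Nat.Partition n)),
            g (i.1, j.1, i.2, j.2) := by
  simp only [labels, Finset.sum_product]
  refine Finset.sum_congr rfl fun E _ => ?_
  rw [Finset.sum_comm]

/-- The trace forces the two output labels to agree; then the two input labels have equal free
energies, and they are forced to agree once `G` is removed by trace preservation. -/
theorem trace_workCostDephased {HX : Matrix x x ℂ} (hX : HX.IsHermitian) (β : ℝ)
    {G : Matrix (Fin n → x) (Fin n → x) ℂ →ₗ[ℂ] Matrix (Fin n → x) (Fin n → x) ℂ}
    (hG : ∀ ρ, (G ρ).trace = ρ.trace) (ρ : Matrix (Fin n → x) (Fin n → x) ℂ) :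
    (workCostDephased β n HX G ρ).trace = ρ.trace := by
  have hP := isResolution_levelProj hX n
  set s := energies (totalHam n HX) ×ˢ (Finset.univ : Finset (Nat.Partition n)) with hs
  set P := levelProj (n := n) HX with hPdef
  -- The free energy of a level.
  let α : ℝ × Nat.Partition n → ℝ := fun i => i.1 - β⁻¹ * shapeEntropy i.2
  have htr : ∀ i i' (X : Matrix (Fin n → x) (Fin n → x) ℂ),
      (P i * X * P i').trace = if i' = i then (P i * X).trace else 0 := by
    intro i i' X
    rw [Matrix.trace_mul_comm, ← mul_assoc]
    split_ifs with h
    · rw [h, hP.mul_self]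
    · rw [hP.mul_of_ne _ _ h, zero_mul, Matrix.trace_zero]
  have hout : ∀ X : Matrix (Fin n → x) (Fin n → x) ℂ, ∑ i ∈ s, (P i * X).trace = X.trace := by
    intro X
    rw [← Matrix.trace_sum, ← Finset.sum_mul, hP.sum_eq_one, one_mul]
  calc (workCostDephased β n HX G ρ).trace
      = ∑ i ∈ s, ∑ j ∈ s, ∑ i' ∈ s, ∑ j' ∈ s, if α i - α j = α i' - α j' then
          (P i * G (P j * ρ * P j') * P i').trace else 0 := by
        rw [workCostDephased_apply, sum_labels_eq_sum_levels]
        simp only [sum_labels_eq_sum_levels, Matrix.trace_sum, apply_ite Matrix.trace,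
          Matrix.trace_zero]
        rfl
    _ = ∑ i ∈ s, ∑ j ∈ s, ∑ j' ∈ s, if α j = α j' then
          (P i * G (P j * ρ * P j')).trace else 0 := by
        refine Finset.sum_congr rfl fun i hi => Finset.sum_congr rfl fun j _ => ?_
        rw [Finset.sum_eq_single i]
        · refine Finset.sum_congr rfl fun j' _ => if_congr (sub_right_inj) ?_ rfl
          rw [htr, if_pos rfl]
        · intro i' _ hi'
          refine Finset.sum_eq_zero fun j' _ => ?_
          rw [htr, if_neg hi', ite_self]
        · exact fun h => absurd hi h
    _ = ∑ j ∈ s, ∑ j' ∈ s, if α j = α j' then (P j * ρ * P j').trace else 0 := by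
        rw [Finset.sum_comm]
        refine Finset.sum_congr rfl fun j _ => ?_
        rw [Finset.sum_comm]
        refine Finset.sum_congr rfl fun j' _ => ?_
        split_ifs
        · rw [hout, hG]
        · exact Finset.sum_const_zero
    _ = ∑ j ∈ s, (P j * ρ).trace := by
        refine Finset.sum_congr rfl fun j hj => ?_
        rw [Finset.sum_eq_single j]
        · rw [if_pos rfl, htr, if_pos rfl]
        · intro j' _ hj'
          rw [htr, if_neg hj', ite_self]
        · exact fun h => absurd hj h
    _ = ρ.trace := hout ρ

theorem isChannel_workCostDephased {HX : Matrix x x ℂ} (hX : HX.IsHermitian) (β : ℝ)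
    {G : Matrix (Fin n → x) (Fin n → x) ℂ →ₗ[ℂ] Matrix (Fin n → x) (Fin n → x) ℂ}
    (hG : IsChannel G) : IsChannel (workCostDephased β n HX G) where
  completelyPositive := posSemidef_ampliation_of_choi <| by
    rw [workCostDephased, choi_ofChoi]
    refine Matrix.posSemidef_sum _ fun w _ => ?_
    have h := hG.posSemidef_choi.mul_mul_conjTranspose_same (choiProj β n HX w)
    rwa [(isHermitian_choiProj hX β w).eq] at h
  tracePreserving := trace_workCostDephased hX β hG.tracePreserving

theorem trace_tensorFamily (A : Fin n → Matrix x x ℂ) :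
    (tensorFamily A).trace = ∏ k, (A k).trace := by
  simp only [Matrix.trace, Matrix.diag_apply, tensorFamily_apply, Finset.prod_univ_sum,
    Fintype.piFinset_univ]

theorem posSemidef_tensorPow {A : Matrix x x ℂ} (hA : A.PosSemidef) :
    (tensorPow n A).PosSemidef := by
  obtain ⟨m, v, hv⟩ := Matrix.posSemidef_iff_eq_sum_vecMulVec.1 hA
  have h : tensorPow n A = ∑ r : Fin n → Fin m,
      Matrix.vecMulVec (fun a => ∏ k, v (r k) (a k)) (star fun a => ∏ k, v (r k) (a k)) := by
    ext a b
    simp only [tensorPow, tensorFamily_apply, hv, Matrix.sum_apply, Matrix.vecMulVec_apply,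
      Pi.star_apply, star_prod, Finset.prod_univ_sum, Fintype.piFinset_univ,
      Finset.prod_mul_distrib]
  rw [h]
  exact Matrix.posSemidef_sum _ fun r _ => Matrix.posSemidef_vecMulVec_self_star _

theorem isChannel_channelPow {F : Matrix x x ℂ →ₗ[ℂ] Matrix x x ℂ} (hF : IsChannel F) (n : ℕ) :
    IsChannel (channelPow n F) where
  completelyPositive := posSemidef_ampliation_of_choi <| by
    have h : choi (channelPow n F) = (tensorPow n (choi F)).submatrix
        (fun p k => (p.1 k, p.2 k)) (fun p k => (p.1 k, p.2 k)) := choi_ofChoi _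
    rw [h]
    exact (posSemidef_tensorPow hF.posSemidef_choi).submatrix _
  tracePreserving ρ := by
    have h : Matrix.traceLinearMap (Fin n → x) ℂ ℂ ∘ₗ channelPow n F
        = Matrix.traceLinearMap (Fin n → x) ℂ ℂ := linearMap_ext_tensorFamily fun A => by
      simp only [LinearMap.comp_apply, channelPow_tensorFamily, Matrix.traceLinearMap_apply,
        trace_tensorFamily, hF.tracePreserving]
    exact LinearMap.congr_fun h ρ

end DephasedChannel

end WorkCost

end

theorem mainTheorem8 {x : Type*} [Fintype x] [DecidableEq x]
    (HX : Matrix x x ℂ) (hHX : HX.IsHermitian) (β : ℝ) (hβ : 0 < β) (n : ℕ) :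
    -- Stinespring form of the work-cost-dephased map of a time-covariant channel
    (∀ F : Matrix x x ℂ →ₗ[ℂ] Matrix x x ℂ,
      WorkCost.IsChannel F → WorkCost.IsTimeCovariant HX F →
      ∀ (e : Type*) [Fintype e] [DecidableEq e]
        (HE : Matrix e e ℂ) (ψ : e → ℂ) (V : Matrix (e × x) (e × x) ℂ),
        WorkCost.IsEnergyConservingDilation HX F HE ψ V →
        ∀ ρ : Matrix (Fin n → x) (Fin n → x) ℂ,
          WorkCost.workCostDephased β n HX (WorkCost.channelPow n F) ρ =
            WorkCost.traceEnv (WorkCost.envDephasing β n HE HX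
              (WorkCost.tensorPow n V *
                WorkCost.tensorEnv (WorkCost.tensorPow n (WorkCost.ketBra ψ)) ρ *
                (WorkCost.tensorPow n V)ᴴ))) ∧
    -- the work-cost-dephased map of `F^{⊗ n}` is a channel, for every channel `F` on `X`
    (∀ F : Matrix x x ℂ →ₗ[ℂ] Matrix x x ℂ, WorkCost.IsChannel F →
      WorkCost.IsChannel (WorkCost.workCostDephased β n HX (WorkCost.channelPow n F))) ∧
    -- more generally, so is the work-cost-dephased map of every channel on `Xⁿ`
    (∀ G : Matrix (Fin n → x) (Fin n → x) ℂ →ₗ[ℂ] Matrix (Fin n → x) (Fin n → x) ℂ,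
      WorkCost.IsChannel G →
      WorkCost.IsChannel (WorkCost.workCostDephased β n HX G)) := by
  refine ⟨fun F _ hcov e _ _ HE ψ V hd ρ => ?_, fun F hF => ?_, fun G hG => ?_⟩
  · exact WorkCost.workCostDephased_channelPow_eq hHX hβ hcov hd ρ
  · exact WorkCost.isChannel_workCostDephased hHX β (WorkCost.isChannel_channelPow hF n)
  · exact WorkCost.isChannel_workCostDephased hHX β hG
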